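/- A digraph with three terminals is a finite directed graph $L$ (at most one arc from a vertex to another; loops and pairs of opposite arcs are allowed) together with three distinct vertices $v_1,v_2,v_3$, called its terminals. Paths are directed and repeat no vertex, and the parity of a path is its number of arcs modulo $2$. For $\{i,j,k\}=\{1,2,3\}$ let $\mathrm{Dir}_L(v_i,v_j)\subseteq\{0,1\}$ be the set of all parities of paths from $v_i$ to $v_j$ in $L-v_k$, and let $\mathrm{Via}_L(v_i,v_k,v_j)\subseteq\{0,1\}$ be the set of all $p$ such that there is a path of parity $p$ from $v_i$ to $v_j$ in $L$ that passes through $v_k$, but no path of parity $p$ from $v_i$ to $v_j$ in $L-v_k$. The sets $\mathrm{Dir}_L(v_i,v_j)$ and $\mathrm{Via}_L(v_i,v_k,v_j)$ together form the parity configuration of $L$. A digraph $L'$ with three terminals, identified in order with those of $L$, is a parity mimicking network of $L$ if it has the same parity configuration as $L$. Lemma. There is a polynomial-time algorithm which, given any digraph $L$ with terminals $v_1,v_2,v_3$ together with the parity configuration of $L$, outputs a parity mimicking network $L'$ of $L$ such that $L'$ has at most $18$ vertices, has no loops, and is planar with $v_1,v_2,v_3$ on a common face; that is, the underlying undirected graph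 of $L'$ has a crossing-free drawing in the plane in which $v_1,v_2,v_3$ all lie on the boundary of one face. -/

import Mathlib

namespace ParityNet

section Paths

variable {V : Type*}

/-- `l` is the vertex sequence of a directed path from `u` to `v` in `D`: consecutive vertices are
joined by an arc directed forwards, and no vertex is repeated. -/
def IsDiPath (D : Digraph V) (u v : V) (l : List V) : Prop :=
  l.IsChain D.Adj ∧ l.Nodup ∧ l.head? = some u ∧ l.getLast? = some v

/-- The parity (number of arcs modulo 2) of a path given by its vertex sequence. -/
def pathParity (l : List V) : ZMod 2 := ((l.length - 1 : ℕ) : ZMod 2)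

/-- There is a path of parity `p` from `u` to `v` in `D - w`. -/
def HasDirectPath (D : Digraph V) (u v w : V) (p : ZMod 2) : Prop :=
  ∃ l, IsDiPath D u v l ∧ w ∉ l ∧ pathParity l = p

/-- There is a path of parity `p` from `u` to `v` in `D` that passes through `w`. -/
def HasPathThrough (D : Digraph V) (u v w : V) (p : ZMod 2) : Prop :=
  ∃ l, IsDiPath D u v l ∧ w ∈ l ∧ pathParity l = p

end Paths

/-- Triples `(i, j, k)` of pairwise distinct indices of terminals. -/
abbrev Triple : Type :=
  {x : Fin 3 × Fin 3 × Fin 3 // x.1 ≠ x.2.1 ∧ x.1 ≠ x.2.2 ∧ x.2.1 ≠ x.2.2}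

/-- A table of sets of parities. For `x = (i, j, k)`, `dir x` stands for `Dir(vᵢ, vⱼ)` and
`via x` for `Via(vᵢ, vₖ, vⱼ)` (paths from `vᵢ` to `vⱼ` via `vₖ`). -/
@[ext]
structure ParityConfig where
  dir : Triple → Finset (ZMod 2)
  via : Triple → Finset (ZMod 2)

/-- A finite digraph (loops and pairs of opposite arcs are allowed) on `n` vertices, with three
distinct terminals `v₀, v₁, v₂`. -/
structure TermDigraph where
  n : ℕ
  graph : Digraph (Fin n)
  term : Fin 3 ↪ Fin n

open Classical in
/-- The parity configuration of a digraph with respect to its three terminals. -/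
noncomputable def TermDigraph.parityConfig (L : TermDigraph) : ParityConfig where
  dir x := Finset.univ.filter fun p =>
    HasDirectPath L.graph (L.term x.1.1) (L.term x.1.2.1) (L.term x.1.2.2) p
  via x := Finset.univ.filter fun p =>
    HasPathThrough L.graph (L.term x.1.1) (L.term x.1.2.1) (L.term x.1.2.2) p ∧
      ¬ HasDirectPath L.graph (L.term x.1.1) (L.term x.1.2.1) (L.term x.1.2.2) p

/-- `L'` is a parity mimicking network of `L`: the `i`-th terminal of `L'` is identified with the
`i`-th terminal of `L`, and the two parity configurations agree. -/
def IsParityMimicking (L' L : TermDigraph) : Prop :=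
  L'.parityConfig = L.parityConfig

section Planarity

/-- The Euclidean plane. -/
abbrev Plane : Type := EuclideanSpace ℝ (Fin 2)

/-- `A` is a simple arc in the plane with end points `x` and `y`. -/
def IsArc (A : Set Plane) (x y : Plane) : Prop :=
  ∃ γ : ℝ → Plane, ContinuousOn γ (Set.Icc 0 1) ∧ Set.InjOn γ (Set.Icc 0 1) ∧
    γ 0 = x ∧ γ 1 = y ∧ γ '' Set.Icc 0 1 = A

/-- A drawing of a simple graph in the plane without crossings: vertices are distinct points, the
edge `uv` is a simple arc joining the points of `u` and `v` that contains no other vertex, and two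
distinct edges meet only in vertices. -/
structure PlaneDrawing {V : Type*} (G : SimpleGraph V) where
  pos : V → Plane
  arc : Sym2 V → Set Plane
  pos_injective : Function.Injective pos
  isArc : ∀ u v, G.Adj u v → IsArc (arc s(u, v)) (pos u) (pos v)
  vertex_on_arc : ∀ e ∈ G.edgeSet, ∀ w, pos w ∈ arc e → w ∈ e
  arc_inter : ∀ e ∈ G.edgeSet, ∀ e' ∈ G.edgeSet, e ≠ e' → arc e ∩ arc e' ⊆ Set.range pos

/-- The set of points of the plane covered by a drawing. -/
def PlaneDrawing.support {V : Type*} {G : SimpleGraph V} (Δ : PlaneDrawing G) : Set Plane :=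
  Set.range Δ.pos ∪ ⋃ e ∈ G.edgeSet, Δ.arc e

/-- The faces of a drawing: the connected components of the complement of its support. -/
def PlaneDrawing.IsFace {V : Type*} {G : SimpleGraph V} (Δ : PlaneDrawing G) (F : Set Plane) :
    Prop :=
  ∃ x ∈ Δ.supportᶜ, F = connectedComponentIn Δ.supportᶜ x

/-- The underlying undirected simple graph of a digraph. -/
def underlying {V : Type*} (D : Digraph V) : SimpleGraph V := SimpleGraph.fromRel D.Adj

/-- The digraph has a crossing-free drawing in the plane in which all three terminals lie on the
boundary of one face. Opposite arcs are drawn along the same curve. -/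
def PlanarWithTerminalsOnFace (L : TermDigraph) : Prop :=
  ∃ (Δ : PlaneDrawing (underlying L.graph)) (F : Set Plane), Δ.IsFace F ∧
    ∀ i, Δ.pos (L.term i) ∈ frontier F

end Planarity

section Encoding

/-- All triples of pairwise distinct indices, in a fixed order. -/
def triples : List Triple :=
  [⟨(0, 1, 2), by decide⟩, ⟨(0, 2, 1), by decide⟩, ⟨(1, 0, 2), by decide⟩,
   ⟨(1, 2, 0), by decide⟩, ⟨(2, 0, 1), by decide⟩, ⟨(2, 1, 0), by decide⟩]

/-- A set of parities as two bits. -/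
def encodeParities (s : Finset (ZMod 2)) : List Bool := [decide (0 ∈ s), decide (1 ∈ s)]

/-- A parity configuration as 24 bits. -/
def ParityConfig.encode (P : ParityConfig) : List Bool :=
  triples.flatMap fun x => encodeParities (P.dir x) ++ encodeParities (P.via x)

open Classical in
/-- A digraph with terminals as a bit string: `n` in unary, closed by a `false`, then the
`n × n` adjacency matrix row by row, then the indicator vectors of the three terminals. -/
noncomputable def TermDigraph.encode (L : TermDigraph) : List Bool :=
  List.replicate L.n true ++ false ::
    (((List.finRange L.n).flatMap fun u => (List.finRange L.n).map fun v =>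
        decide (L.graph.Adj u v)) ++
      (List.finRange 3).flatMap fun i => (List.finRange L.n).map fun v =>
        decide (L.term i = v))

/-- An input, that is a digraph with terminals and a parity configuration, as a bit string. -/
noncomputable def encodeInput (I : TermDigraph × ParityConfig) : List Bool :=
  I.2.encode ++ I.1.encode

theorem mem_triples (x : Triple) : x ∈ triples := by
  revert x; decide

theorem encodeParities_injective : Function.Injective encodeParities := by
  decide

theorem ParityConfig.encode_length (P : ParityConfig) : P.encode.length = 24 := by
  simp [ParityConfig.encode, triples, encodeParities]

theorem flatMap_inj {α β : Type*} (f g : α → List β) (l : List α)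
    (hl : ∀ x ∈ l, (f x).length = (g x).length) (h : l.flatMap f = l.flatMap g) :
    ∀ x ∈ l, f x = g x := by
  induction l with
  | nil => simp
  | cons a l ih =>
    rw [List.flatMap_cons, List.flatMap_cons] at h
    obtain ⟨h1, h2⟩ := List.append_inj h (hl a (by simp))
    intro x hx
    rcases List.mem_cons.1 hx with rfl | hx
    · exact h1
    · exact ih (fun y hy => hl y (List.mem_cons_of_mem _ hy)) h2 x hx

theorem ParityConfig.encode_injective : Function.Injective ParityConfig.encode := by
  intro P Q h
  have key : ∀ x, P.dir x = Q.dir x ∧ P.via x = Q.via x := by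
    intro x
    have := flatMap_inj _ _ triples (by intro x _; simp [encodeParities]) h x (mem_triples x)
    obtain ⟨h1, h2⟩ := List.append_inj this (by simp [encodeParities])
    exact ⟨encodeParities_injective h1, encodeParities_injective h2⟩
  ext1
  · exact funext fun x => (key x).1
  · exact funext fun x => (key x).2

theorem replicate_inj {a b : ℕ} {l m : List Bool}
    (h : List.replicate a true ++ false :: l = List.replicate b true ++ false :: m) :
    a = b ∧ l = m := by
  induction a generalizing b with
  | zero => cases b <;> simp_all [List.replicate_succ]
  | succ a ih =>
    cases b with
    | zero => simp [List.replicate_succ] at h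
    | succ b =>
      simp only [List.replicate_succ, List.cons_append, List.cons.injEq, true_and] at h
      obtain ⟨h1, h2⟩ := ih h
      exact ⟨by rw [h1], h2⟩

theorem TermDigraph.encode_injective : Function.Injective TermDigraph.encode := by
  classical
  rintro ⟨n, G, t⟩ ⟨m, H, s⟩ h
  obtain ⟨h0, h⟩ := replicate_inj h
  dsimp only at h0
  subst h0
  obtain ⟨h1, h2⟩ := List.append_inj h (by simp [List.length_flatMap])
  have hG : G = H := by
    ext u v
    have h3 := flatMap_inj _ _ _ (by intros; simp) h1 u (List.mem_finRange u)
    have h4 := List.map_inj_left.1 h3 v (List.mem_finRange v)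
    simpa using h4
  have ht : t = s := by
    ext1 i
    have h3 := flatMap_inj _ _ _ (by intros; simp) h2 i (List.mem_finRange i)
    have h4 := List.map_inj_left.1 h3 (t i) (List.mem_finRange _)
    have h5 : s i = t i := by simpa using h4
    exact h5.symm
  rw [hG, ht]

theorem encodeInput_injective : Function.Injective encodeInput := by
  rintro ⟨L, P⟩ ⟨L', P'⟩ h
  obtain ⟨h1, h2⟩ := List.append_inj h (by simp [ParityConfig.encode_length])
  exact Prod.ext (TermDigraph.encode_injective h2) (ParityConfig.encode_injective h1)

end Encoding

end ParityNet

/-!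
The proof has three independent parts: a description of the parity configurations that occur, planar
networks for all of them, and a Turing machine.

*Configurations.* For each ordered pair `(u, v)` of terminals, with third terminal `w`, let
`d(u, v)` be the set of parities of the paths from `u` to `v` that avoid `w`, let `t(u, v)` be the
set of parities of all paths from `u` to `v`, and let `s(u, v) = d(u, w) + d(w, v)`. A path through
`w` is the union of two paths counted by `d(u, w)` and `d(w, v)`, so `d ⊆ t ⊆ d ∪ s`. If `d(u, v)`
is empty, then moreover `t(u, v) = s(u, v)`: a path from `u` to `w` and a path from `w` to `v` meet
only in `w`, because otherwise one could change over from one to the other and avoid `w`. Hence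
either `d(u, v)` is empty and `t(u, v) = s(u, v)`, or `t(u, v)` is one of `d(u, v)` and
`d(u, v) ∪ s(u, v)` (`Config.Describes.feasible`).

*Networks.* Conversely, all configurations that satisfy these conditions are realized by digraphs
whose underlying graph is contained in one fixed plane graph with 18 vertices, drawn with straight
edges and with the terminals on a parabola that has the rest of the drawing above it
(`Config.planar_of_feasible`). The class of the realizable configurations is closed under
permutations of the terminals, under reversal of all arcs, and under adding an arc or a path of
length two from one terminal to another along the boundary of the drawing. The effect of the last
operation on the configuration can be computed from the configuration alone (`IsEar.describes`),
since a path between terminals that uses the new path consists of it and at most one old path. By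
induction on the size of the sets `d`, it remains to realize the configurations that do not arise in
this way from a smaller one. Up to symmetry there are 125 of these; they are listed in `coreTable`,
each with a network, whose paths are enumerated. That the list is complete is checked by running
through all configurations (`all_settled`).

*Machine.* The parity configuration is written in the first 24 bits of the input, and the output
depends on nothing else. So a machine can read these bits into its finite memory, erase the rest of
the input, and write down the corresponding network (`nonempty_computableInPolyTime_of_prefix`).
-/

namespace ParityNet

/-! ### Functions of a bounded prefix are computable in polynomial time -/

section PolyTime

open Turing

/-- Bit strings of bounded length: the registers of the machine `prefixMachine`. -/
abbrev ShortList (M : ℕ) : Type := {l : List Bool // l.length ≤ M}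

noncomputable instance (M : ℕ) : Fintype (ShortList M) :=
  @Fintype.ofFinite _ (List.finite_length_le Bool M)

/-- Truncate a bit string to a register of length `M`. -/
def ShortList.trunc (M : ℕ) (l : List Bool) : ShortList M := ⟨l.take M, by simp⟩

/-- A machine with a single stack. In the loop `false` it pops all of its input, remembers the
first `N` bits `l` in its register, and finally replaces them by `out l`. In the loop `true` it
pushes the contents of the register. The Boolean component of the state tells whether the input has
been exhausted. -/
noncomputable def prefixMachine (N M : ℕ) (out : List Bool → List Bool) : FinTM2 where
  K := Unit
  k₀ := ()
  k₁ := ()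
  Γ _ := Bool
  Λ := Bool
  main := false
  σ := ShortList M × Bool
  initialState := (ShortList.trunc M [], false)
  Γk₀Fin := inferInstanceAs (Fintype Bool)
  m b := match b with
    | false =>
      .pop () (fun s o => match o with
        | some b => (ShortList.trunc M ((s.1.1 ++ [b]).take N), false)
        | none => (ShortList.trunc M (out s.1.1), true))
      (.branch (fun s => s.2) (.goto fun _ => true) (.goto fun _ => false))
    | true =>
      .branch (fun s => s.1.1.isEmpty) (.load (fun _ => (ShortList.trunc M [], false)) .halt)
        (.push () (fun s => s.1.1.headD false)
          (.load (fun s => (ShortList.trunc M s.1.1.tail, true)) (.goto fun _ => true)))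

variable {N M : ℕ} {out : List Bool → List Bool}

/-- A configuration of `prefixMachine`. -/
noncomputable def prefixCfg (N M : ℕ) (out : List Bool → List Bool) (b : Option Bool)
    (s : ShortList M × Bool) (l : List Bool) : (prefixMachine N M out).Cfg :=
  ⟨b, s, fun _ => l⟩

theorem prefixMachine_step_nil (s : ShortList M × Bool) :
    (prefixMachine N M out).step (prefixCfg N M out (some false) s []) =
      some (prefixCfg N M out (some true) (ShortList.trunc M (out s.1.1), true) []) := by
  simp only [FinTM2.step, prefixCfg, prefixMachine, TM2.step, TM2.stepAux]
  congr

theorem prefixMachine_step_cons (s : ShortList M × Bool) (b : Bool) (l : List Bool) :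
    (prefixMachine N M out).step (prefixCfg N M out (some false) s (b :: l)) =
      some (prefixCfg N M out (some false)
        (ShortList.trunc M ((s.1.1 ++ [b]).take N), false) l) := by
  simp only [FinTM2.step, prefixCfg, prefixMachine, TM2.step, TM2.stepAux]
  congr

theorem prefixMachine_step_write (b : Bool) (l r : List Bool) (h : (b :: l).length ≤ M) :
    (prefixMachine N M out).step
        (prefixCfg N M out (some true) (ShortList.trunc M (b :: l), true) r) =
      some (prefixCfg N M out (some true) (ShortList.trunc M l, true) (b :: r)) := by
  have h1 : (ShortList.trunc M (b :: l)).1 = b :: l := List.take_of_length_le h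
  simp only [FinTM2.step, prefixCfg, prefixMachine, TM2.step, TM2.stepAux, h1]
  congr

theorem prefixMachine_step_halt (r : List Bool) :
    (prefixMachine N M out).step
        (prefixCfg N M out (some true) (ShortList.trunc M [], true) r) =
      some (prefixCfg N M out none (ShortList.trunc M [], false) r) := by
  have h1 : (ShortList.trunc M []).1 = [] := by simp [ShortList.trunc]
  simp only [FinTM2.step, prefixCfg, prefixMachine, TM2.step, TM2.stepAux, h1]
  congr

theorem iterate_bind_some {σ : Type*} (f : σ → Option σ) {a b : σ} (h : f a = some b) (n : ℕ) :
    (flip bind f)^[n + 1] (some a) = (flip bind f)^[n] (some b) := by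
  rw [Function.iterate_succ_apply]
  congr

theorem prefixMachine_write (l r : List Bool) (h : l.length ≤ M) :
    (flip bind (prefixMachine N M out).step)^[l.length + 1]
        (some (prefixCfg N M out (some true) (ShortList.trunc M l, true) r)) =
      some (prefixCfg N M out none (ShortList.trunc M [], false) (l.reverse ++ r)) := by
  induction l generalizing r with
  | nil => exact iterate_bind_some _ (prefixMachine_step_halt r) 0
  | cons b l ih =>
    rw [List.length_cons, iterate_bind_some _ (prefixMachine_step_write b l r h),
      ih (b :: r) (by simp at h; omega)]
    simp

theorem prefixMachine_read (hNM : N ≤ M) (a l : List Bool) (x : Bool) :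
    (flip bind (prefixMachine N M out).step)^[l.length + 1]
        (some (prefixCfg N M out (some false) (ShortList.trunc M (a.take N), x) l)) =
      some (prefixCfg N M out (some true)
        (ShortList.trunc M (out ((a ++ l).take N)), true) []) := by
  have key : ∀ b : List Bool, (ShortList.trunc M (b.take N)).1 = b.take N := fun b =>
    List.take_of_length_le ((List.length_take_le _ _).trans hNM)
  induction l generalizing a x with
  | nil =>
    refine (iterate_bind_some _ (prefixMachine_step_nil _) 0).trans ?_
    simp [key]
  | cons b l ih =>
    rw [List.length_cons, iterate_bind_some _ (prefixMachine_step_cons _ b l)]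
    have h2 : ((ShortList.trunc M (a.take N)).1 ++ [b]).take N = (a ++ [b]).take N := by
      rw [key]
      simp [List.take_append, List.take_take]
      rcases le_total N a.length with h | h
      · simp [h]
      · simp [h]
    rw [h2, ih (a ++ [b])]
    simp

/-- A function whose value depends only on a prefix of bounded length of the encoding of its
argument is computable in polynomial (indeed linear) time: the finitely many possible outputs are
stored in the machine. -/
theorem nonempty_computableInPolyTime_of_prefix {α β : Type} (ea : α → List Bool)
    (eb : β → List Bool) (N : ℕ) (g : List Bool → β) :
    Nonempty (TM2ComputableInPolyTime ea eb fun a => g ((ea a).take N)) := by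
  obtain ⟨B, hB⟩ : ∃ B, ∀ l : List Bool, l.length ≤ N → (eb (g l)).reverse.length ≤ B := by
    obtain ⟨B, hB⟩ := ((List.finite_length_le Bool N).image
      fun l => (eb (g l)).reverse.length).bddAbove
    exact ⟨B, fun l hl => hB ⟨l, hl, rfl⟩⟩
  let out : List Bool → List Bool := fun l => (eb (g l)).reverse
  let M := max N B
  have hM : ∀ l, l.length ≤ N → (out l).length ≤ M := fun l hl => (hB l hl).trans (le_max_right _ _)
  refine ⟨⟨⟨prefixMachine N M out, Equiv.refl _, Equiv.refl _⟩, Polynomial.X + Polynomial.C (M + 2),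
    fun a => ⟨⟨((out ((ea a).take N)).length + 1) + ((ea a).length + 1), ?_⟩, ?_⟩⟩⟩
  · have e1 : initList (prefixMachine N M out) (List.map (Equiv.refl _).invFun (ea a)) =
        prefixCfg N M out (some false) (ShortList.trunc M (([] : List Bool).take N), false)
          (ea a) := by
      simp only [initList, prefixCfg, prefixMachine]
      congr
      · simp
      · funext k
        simp
        rfl
    have e2 : haltList (prefixMachine N M out)
        (List.map (Equiv.refl _).invFun (eb (g ((ea a).take N)))) =
        prefixCfg N M out none (ShortList.trunc M [], false) (eb (g ((ea a).take N))) := by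
      simp only [haltList, prefixCfg, prefixMachine]
      congr
      funext k
      simp
      rfl
    rw [Function.iterate_add_apply]
    erw [e1, prefixMachine_read (le_max_left _ _) [] (ea a) false,
      List.nil_append, prefixMachine_write _ _ (hM _ (by simp)), Option.map_some, e2]
    simp [out]
  · have := hM ((ea a).take N) (by simp)
    simp only [Polynomial.eval_add, Polynomial.eval_X, Polynomial.eval_C]
    omega

end PolyTime

/-! ### Directed paths and the constraints on configurations -/

section DiPaths

variable {V : Type*} {D D' : Digraph V} {u v w x : V} {l l₁ l₂ : List V}

theorem IsDiPath.split (h : IsDiPath D u v (l₁ ++ x :: l₂)) :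
    IsDiPath D u x (l₁ ++ [x]) ∧ IsDiPath D x v (x :: l₂) := by
  obtain ⟨hc, hn, hh, hl⟩ := h
  obtain ⟨hc1, hc2⟩ := List.isChain_split.1 hc
  refine ⟨⟨hc1, ?_, ?_, by simp⟩, hc2, (List.nodup_append.1 hn).2.1, rfl, ?_⟩
  · have : List.Sublist (l₁ ++ [x]) (l₁ ++ x :: l₂) := by simp
    exact hn.sublist this
  · cases l₁ <;> simpa using hh
  · simpa [List.getLast?_append] using hl

theorem IsDiPath.join (h₁ : IsDiPath D u x (l₁ ++ [x])) (h₂ : IsDiPath D x v (x :: l₂))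
    (h : ∀ z ∈ l₁, z ∉ x :: l₂) : IsDiPath D u v (l₁ ++ x :: l₂) := by
  refine ⟨List.isChain_split.2 ⟨h₁.1, h₂.1⟩, ?_, ?_, ?_⟩
  · refine List.nodup_append.2 ⟨(List.nodup_append.1 h₁.2.1).1, h₂.2.1, ?_⟩
    rintro a ha b hb rfl
    exact h a ha hb
  · have := h₁.2.2.1
    cases l₁ <;> simpa using this
  · simpa [List.getLast?_append] using h₂.2.2.2

theorem pathParity_split (l₁ l₂ : List V) (x : V) :
    pathParity (l₁ ++ x :: l₂) = pathParity (l₁ ++ [x]) + pathParity (x :: l₂) := by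
  simp only [pathParity, ← Nat.cast_add]
  congr 1
  simp

theorem IsDiPath.start_mem (h : IsDiPath D u v l) : u ∈ l := List.mem_of_mem_head? h.2.2.1

theorem IsDiPath.end_mem (h : IsDiPath D u v l) : v ∈ l := List.mem_of_mem_getLast? h.2.2.2

theorem IsDiPath.eq_concat (h : IsDiPath D u v l) : ∃ l', l = l' ++ [v] := by
  obtain ⟨l', hl⟩ := List.getLast?_eq_some_iff.1 h.2.2.2
  exact ⟨l', hl⟩

theorem IsDiPath.eq_cons (h : IsDiPath D u v l) : ∃ l', l = u :: l' := by
  obtain ⟨l', hl⟩ := List.head?_eq_some_iff.1 h.2.2.1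
  exact ⟨l', hl⟩

theorem IsDiPath.mono (h : IsDiPath D u v l) (hD : ∀ a b, D.Adj a b → D'.Adj a b) :
    IsDiPath D' u v l :=
  ⟨h.1.imp fun a b => hD a b, h.2⟩

/-- The digraph with all arcs reversed. -/
def revDigraph (D : Digraph V) : Digraph V where
  Adj a b := D.Adj b a

theorem IsDiPath.reverse (h : IsDiPath D u v l) : IsDiPath (revDigraph D) v u l.reverse := by
  refine ⟨?_, by simpa using h.2.1, by simpa using h.2.2.2, by simpa using h.2.2.1⟩
  rw [List.isChain_reverse]
  exact h.1

theorem pathParity_reverse (l : List V) : pathParity l.reverse = pathParity l := by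
  simp [pathParity]

/-- A path through `w` is the union of two paths that meet only in `w`. -/
theorem exists_paths_of_path_through {p : ZMod 2} (hl : IsDiPath D u v l) (hw : w ∈ l)
    (huw : u ≠ w) (hvw : v ≠ w) (hp : pathParity l = p) :
    ∃ q r, q + r = p ∧ HasDirectPath D u w v q ∧ HasDirectPath D w v u r := by
  obtain ⟨l₁, l₂, rfl⟩ := List.append_of_mem hw
  obtain ⟨h1, h2⟩ := hl.split
  have hd := (List.nodup_append.1 hl.2.1).2.2
  refine ⟨_, _, (pathParity_split l₁ l₂ w).symm.trans hp, ⟨_, h1, ?_, rfl⟩, ⟨_, h2, ?_, rfl⟩⟩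
  · intro hv
    have h3 : v ∈ l₁ := by simpa [hvw] using hv
    exact hd v h3 v h2.end_mem rfl
  · intro hu
    have h3 : u ∈ l₁ := by simpa [huw] using h1.start_mem
    exact hd u h3 u hu rfl

/-- If `v` cannot be reached from `u` avoiding `w`, then every path from `u` to `w` can be
prolonged by every path from `w` to `v`: at the first vertex where the former meets the latter
outside `w` one could change over and avoid `w`. -/
theorem exists_path_of_forall_not_hasDirectPath (h : ∀ p, ¬ HasDirectPath D u v w p)
    {q r : ZMod 2} (hq : HasDirectPath D u w v q) (hr : HasDirectPath D w v u r) :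
    ∃ l, IsDiPath D u v l ∧ pathParity l = q + r := by
  obtain ⟨P, hP, -, rfl⟩ := hq
  obtain ⟨Q, hQ, -, rfl⟩ := hr
  obtain ⟨P', rfl⟩ := hP.eq_concat
  obtain ⟨Q', rfl⟩ := hQ.eq_cons
  have hdisj : ∀ z ∈ P', z ∉ w :: Q' := by
    by_contra! hcon
    obtain ⟨z, hz, hzQ⟩ := hcon
    classical
    -- the first vertex of `P'` that lies on the second path
    obtain ⟨y, hy⟩ : ∃ y, P'.find? (fun z => z ∈ w :: Q') = some y := by
      rw [← Option.isSome_iff_exists, List.find?_isSome]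
      exact ⟨z, hz, by simpa using hzQ⟩
    obtain ⟨hyQ, A, B, rfl, hA⟩ := List.find?_eq_some_iff_append.1 hy
    have hyQ : y ∈ w :: Q' := by simpa using hyQ
    have hyw : y ≠ w := by
      rintro rfl
      have := hP.2.1
      simp [List.nodup_append] at this
    have hyQ' : y ∈ Q' := by simpa [hyw] using hyQ
    obtain ⟨A', B', rfl⟩ := List.append_of_mem hyQ'
    have h1 : IsDiPath D u y (A ++ [y]) := by
      have hP' : IsDiPath D u w (A ++ y :: (B ++ [w])) := by simpa using hP
      exact hP'.split.1
    have h2 : IsDiPath D y v (y :: B') := by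
      have hQ' : IsDiPath D w v ((w :: A') ++ y :: B') := by simpa using hQ
      exact hQ'.split.2
    have hA' : ∀ z ∈ A, z ∉ w :: (A' ++ y :: B') := by
      intro z hz
      simpa using hA z hz
    refine h _ ⟨_, h1.join h2 fun z hz hz' => hA' z hz ?_, ?_, rfl⟩
    · simp only [List.mem_cons, List.mem_append] at hz' ⊢
      tauto
    · intro hw
      rcases List.mem_append.1 hw with hw | hw
      · exact hA' w hw (by simp)
      · have := hQ.2.1
        simp only [List.nodup_cons, List.mem_append] at this
        tauto
  exact ⟨_, hP.join hQ hdisj, pathParity_split _ _ _⟩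

end DiPaths

section Configurations

/-- A set of parities, as the two truth values of `0 ∈ s` and of `1 ∈ s`. -/
abbrev ParSet : Type := Bool × Bool

namespace ParSet

/-- Membership in a set of parities. -/
def Has (s : ParSet) (p : ZMod 2) : Prop := (if p = 0 then s.1 else s.2) = true

instance (s : ParSet) (p : ZMod 2) : Decidable (s.Has p) := inferInstanceAs (Decidable (_ = _))

/-- The set of all sums of an element of `s` and an element of `t`. -/
def sum (s t : ParSet) : ParSet := (s.1 && t.1 || s.2 && t.2, s.1 && t.2 || s.2 && t.1)

/-- Union of sets of parities. -/
def union (s t : ParSet) : ParSet := (s.1 || t.1, s.2 || t.2)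

/-- The set with the single element `1` if `q` is true, and `0` if `q` is false. -/
def single (q : Bool) : ParSet := (!q, q)

theorem has_union {s t : ParSet} {p : ZMod 2} : (s.union t).Has p ↔ s.Has p ∨ t.Has p := by
  revert s t p; decide

theorem has_sum {s t : ParSet} {p : ZMod 2} :
    (s.sum t).Has p ↔ ∃ q r, q + r = p ∧ s.Has q ∧ t.Has r := by
  revert s t p; decide

theorem has_single {q : Bool} {p : ZMod 2} : (single q).Has p ↔ p = q.toNat := by
  revert q p; decide

theorem exists_has_iff (P : ZMod 2 → Prop) : ∃ s : ParSet, ∀ p, s.Has p ↔ P p := by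
  classical
  refine ⟨(decide (P 0), decide (P 1)), fun p => ?_⟩
  rcases (by decide : ∀ p : ZMod 2, p = 0 ∨ p = 1) p with rfl | rfl <;> simp [Has]

end ParSet

/-- The data of a parity configuration for one ordered pair `(u, v)` of terminals: the parities of
the paths from `u` to `v` that avoid the third terminal, and those of all paths from `u` to `v`. -/
structure Link where
  direct : ParSet
  total : ParSet
deriving DecidableEq

/-- A configuration: one link for each ordered pair of the three terminals; `xij` is the link from
terminal `i` to terminal `j`. -/
@[ext]
structure Config where
  x01 : Link
  x02 : Link
  x10 : Link
  x12 : Link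
  x20 : Link
  x21 : Link

/-- The constraint on a link that comes from the paths through the third terminal, where `s` is the
set of sums of the parities of a direct path to that terminal and of a direct path from there. -/
def Link.feasible (x : Link) (s : ParSet) : Bool :=
  if x.direct = (false, false) then x.total = s
  else x.total = x.direct ∨ x.total = x.direct.union s

/-- The constraints that hold for the configuration of every digraph. -/
def Config.feasible (c : Config) : Bool :=
  c.x01.feasible (c.x02.direct.sum c.x21.direct) && c.x02.feasible (c.x01.direct.sum c.x12.direct)
  && c.x10.feasible (c.x12.direct.sum c.x20.direct)
  && c.x12.feasible (c.x10.direct.sum c.x02.direct)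
  && c.x20.feasible (c.x21.direct.sum c.x10.direct)
  && c.x21.feasible (c.x20.direct.sum c.x01.direct)

variable {V : Type*} {D : Digraph V} {u v w : V}

/-- The link `x` records the parities of the paths from `u` to `v`, the third terminal being `w`. -/
structure Link.Describes (x : Link) (D : Digraph V) (u v w : V) : Prop where
  direct : ∀ p, x.direct.Has p ↔ HasDirectPath D u v w p
  total : ∀ p, x.total.Has p ↔ ∃ l, IsDiPath D u v l ∧ pathParity l = p

/-- `c` is the configuration of `D` with respect to the terminals `u`, `v`, `w`. -/
structure Config.Describes (c : Config) (D : Digraph V) (u v w : V) : Prop where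
  x01 : c.x01.Describes D u v w
  x02 : c.x02.Describes D u w v
  x10 : c.x10.Describes D v u w
  x12 : c.x12.Describes D v w u
  x20 : c.x20.Describes D w u v
  x21 : c.x21.Describes D w v u

theorem Link.exists_describes (D : Digraph V) (u v w : V) : ∃ x : Link, x.Describes D u v w := by
  obtain ⟨s, hs⟩ := ParSet.exists_has_iff (HasDirectPath D u v w)
  obtain ⟨t, ht⟩ := ParSet.exists_has_iff fun p => ∃ l, IsDiPath D u v l ∧ pathParity l = p
  exact ⟨⟨s, t⟩, hs, ht⟩

theorem Config.exists_describes (D : Digraph V) (u v w : V) :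
    ∃ c : Config, c.Describes D u v w := by
  obtain ⟨x01, h01⟩ := Link.exists_describes D u v w
  obtain ⟨x02, h02⟩ := Link.exists_describes D u w v
  obtain ⟨x10, h10⟩ := Link.exists_describes D v u w
  obtain ⟨x12, h12⟩ := Link.exists_describes D v w u
  obtain ⟨x20, h20⟩ := Link.exists_describes D w u v
  obtain ⟨x21, h21⟩ := Link.exists_describes D w v u
  exact ⟨⟨x01, x02, x10, x12, x20, x21⟩, h01, h02, h10, h12, h20, h21⟩

theorem Link.feasible_of_subset {d t s : ParSet} (h1 : ∀ p, d.Has p → t.Has p)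
    (h2 : ∀ p, t.Has p → d.Has p ∨ s.Has p)
    (h3 : (∀ p, ¬ d.Has p) → ∀ p, s.Has p → t.Has p) : (Link.mk d t).feasible s = true := by
  revert d t s; decide

theorem Link.Describes.feasible {x y z : Link} (hx : x.Describes D u v w)
    (hy : y.Describes D u w v) (hz : z.Describes D w v u) (huw : u ≠ w) (hvw : v ≠ w) :
    x.feasible (y.direct.sum z.direct) = true := by
  refine Link.feasible_of_subset ?_ ?_ ?_
  · intro p hp
    obtain ⟨l, hl, -, hp⟩ := (hx.direct p).1 hp
    exact (hx.total p).2 ⟨l, hl, hp⟩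
  · intro p hp
    obtain ⟨l, hl, hp⟩ := (hx.total p).1 hp
    by_cases hw : w ∈ l
    · obtain ⟨q, r, h, h1, h2⟩ := exists_paths_of_path_through hl hw huw hvw hp
      exact .inr (ParSet.has_sum.2 ⟨q, r, h, (hy.direct q).2 h1, (hz.direct r).2 h2⟩)
    · exact .inl ((hx.direct p).2 ⟨l, hl, hw, hp⟩)
  · intro h p hp
    obtain ⟨q, r, rfl, h1, h2⟩ := ParSet.has_sum.1 hp
    exact (hx.total _).2 (exists_path_of_forall_not_hasDirectPath
      (fun p hp => h p ((hx.direct p).2 hp)) ((hy.direct q).1 h1) ((hz.direct r).1 h2))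

theorem Config.Describes.feasible {c : Config} (h : c.Describes D u v w) (huv : u ≠ v)
    (huw : u ≠ w) (hvw : v ≠ w) : c.feasible = true := by
  simp only [Config.feasible, Bool.and_eq_true]
  exact ⟨⟨⟨⟨⟨h.x01.feasible h.x02 h.x21 huw hvw, h.x02.feasible h.x01 h.x12 huv hvw.symm⟩,
    h.x10.feasible h.x12 h.x20 hvw huw⟩, h.x12.feasible h.x10 h.x02 huv.symm huw.symm⟩,
    h.x20.feasible h.x21 h.x10 hvw.symm huv⟩, h.x21.feasible h.x20 h.x01 huw.symm huv.symm⟩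

end Configurations

/-! ### Symmetries, and adding a path between two terminals -/

section Symmetry

variable {V : Type*} {D : Digraph V} {u v w : V} {c : Config}

/-- The configuration after exchanging the first two terminals. -/
def Config.swap (c : Config) : Config := ⟨c.x10, c.x12, c.x01, c.x02, c.x21, c.x20⟩

/-- The configuration after moving the first terminal to the last place. -/
def Config.rotate (c : Config) : Config := ⟨c.x12, c.x10, c.x21, c.x20, c.x01, c.x02⟩

/-- The configuration after reversing all arcs. -/
def Config.reverse (c : Config) : Config := ⟨c.x10, c.x20, c.x01, c.x21, c.x02, c.x12⟩

theorem Config.Describes.swap (h : c.Describes D u v w) : c.swap.Describes D v u w :=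
  ⟨h.x10, h.x12, h.x01, h.x02, h.x21, h.x20⟩

theorem Config.Describes.rotate (h : c.Describes D u v w) : c.rotate.Describes D v w u :=
  ⟨h.x12, h.x10, h.x21, h.x20, h.x01, h.x02⟩

theorem Link.Describes.reverse {x : Link} (h : x.Describes D u v w) :
    x.Describes (revDigraph D) v u w := by
  refine ⟨fun p => (h.direct p).trans ⟨?_, ?_⟩, fun p => (h.total p).trans ⟨?_, ?_⟩⟩
  · rintro ⟨l, hl, hw, rfl⟩
    exact ⟨_, hl.reverse, by simpa using hw, pathParity_reverse l⟩
  · rintro ⟨l, hl, hw, rfl⟩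
    exact ⟨_, hl.reverse, by simpa using hw, pathParity_reverse l⟩
  · rintro ⟨l, hl, rfl⟩
    exact ⟨_, hl.reverse, pathParity_reverse l⟩
  · rintro ⟨l, hl, rfl⟩
    exact ⟨_, hl.reverse, pathParity_reverse l⟩

theorem Config.Describes.reverse (h : c.Describes D u v w) :
    c.reverse.Describes (revDigraph D) u v w :=
  ⟨h.x10.reverse, h.x20.reverse, h.x01.reverse, h.x21.reverse, h.x02.reverse, h.x12.reverse⟩

end Symmetry

section Ears

variable {V : Type*} {D D' : Digraph V} {u v w x y m : V} {M l : List V}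

/-- `D'` arises from `D` by adding a path from `u` to `v` with the list `M` of inner vertices; every
path between terminals that is not a path of `D` runs through the whole added path, and every path
between terminals that contains a vertex of `M` contains `u` and `v`. -/
structure IsEar (D D' : Digraph V) (u v w : V) (M : List V) : Prop where
  mono : ∀ a b, D.Adj a b → D'.Adj a b
  isDiPath : IsDiPath D' u v (u :: (M ++ [v]))
  notMem : w ∉ M
  isChain : ∀ x ∈ [u, v, w], ∀ y ∈ [u, v, w], ∀ l, IsDiPath D' x y l →
    l.IsChain D.Adj ∨ ∃ A B, l = A ++ u :: (M ++ v :: B)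
  mem : ∀ x ∈ [u, v, w], ∀ y ∈ [u, v, w], ∀ l, IsDiPath D' x y l → ∀ z ∈ M, z ∈ l → u ∈ l ∧ v ∈ l

theorem isDiPath_self_iff : IsDiPath D u u l ↔ l = [u] := by
  constructor
  · intro h
    obtain ⟨l', rfl⟩ := h.eq_cons
    rcases List.eq_nil_or_concat' l' with rfl | ⟨L, b, rfl⟩
    · rfl
    · have h1 := h.2.1
      have h2 := h.2.2.2
      have h3 : b = u := by simpa [List.getLast?_cons] using h2
      simp [h3] at h1
  · rintro rfl
    simp [IsDiPath]

/-- A path between terminals is old, or it consists of the added path and of old paths before and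
after it that avoid one end of the added path. -/
theorem IsEar.cases (h : IsEar D D' u v w M) (hx : x ∈ [u, v, w]) (hy : y ∈ [u, v, w])
    (hl : IsDiPath D' x y l) :
    IsDiPath D x y l ∨ ∃ A B, IsDiPath D x u (A ++ [u]) ∧ IsDiPath D v y (v :: B) ∧
      v ∉ A ++ [u] ∧ u ∉ v :: B ∧ l = A ++ u :: (M ++ v :: B) := by
  rcases h.isChain x hx y hy l hl with hc | ⟨A, B, rfl⟩
  · exact .inl ⟨hc, hl.2⟩
  · obtain ⟨h1, h2⟩ := hl.split
    obtain ⟨-, h3⟩ := h2.split (l₁ := u :: M)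
    have hn := hl.2.1
    have hv : v ∉ A ++ [u] := by
      simp only [List.nodup_append, List.nodup_cons, List.mem_append, List.mem_cons] at hn
      intro hv
      rcases List.mem_append.1 hv with hv | hv
      · exact hn.2.2 v hv v (by simp) rfl
      · rw [List.mem_singleton] at hv
        exact hn.2.1.1 (by simp [hv])
    have hu : u ∉ v :: B := by
      simp only [List.nodup_append, List.nodup_cons, List.mem_append, List.mem_cons] at hn
      intro hu
      exact hn.2.1.1 (by right; simpa using hu)
    refine .inr ⟨A, B, ?_, ?_, hv, hu, rfl⟩
    · rcases h.isChain x hx u (by simp) _ h1 with hc | ⟨A', B', h'⟩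
      · exact ⟨hc, h1.2⟩
      · rw [h'] at hv
        simp at hv
    · rcases h.isChain v (by simp) y hy _ h3 with hc | ⟨A', B', h'⟩
      · exact ⟨hc, h3.2⟩
      · rw [h'] at hu
        simp at hu

theorem IsEar.path_iff_of_ne (h : IsEar D D' u v w M) (hx : x ∈ [u, v, w]) (hy : y ∈ [u, v, w])
    (hxy : x = v ∨ y = u) : IsDiPath D' x y l ↔ IsDiPath D x y l := by
  refine ⟨fun hl => ?_, fun hl => hl.mono h.mono⟩
  rcases h.cases hx hy hl with hl | ⟨A, B, h1, h2, h3, h4, -⟩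
  · exact hl
  · rcases hxy with rfl | rfl
    · exact absurd h1.start_mem h3
    · exact absurd h2.end_mem h4

theorem Link.Describes.congr {z : Link} (hz : z.Describes D x y w)
    (h : ∀ l, IsDiPath D' x y l ↔ IsDiPath D x y l) : z.Describes D' x y w :=
  ⟨fun p => (hz.direct p).trans (by simp only [HasDirectPath, h]),
    fun p => (hz.total p).trans (by simp only [h])⟩

variable {c : Config} {q : Bool}

/-- The configuration after adding a path of parity `q` from the first to the second terminal. -/
def Config.addPath (q : Bool) (c : Config) : Config where
  x01 := ⟨c.x01.direct.union (.single q), c.x01.total.union (.single q)⟩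
  x02 := ⟨c.x02.direct, c.x02.total.union ((ParSet.single q).sum c.x12.direct)⟩
  x10 := c.x10
  x12 := c.x12
  x20 := c.x20
  x21 := ⟨c.x21.direct, c.x21.total.union (c.x20.direct.sum (.single q))⟩

theorem IsEar.eq_ear (h : IsEar D D' u v w M) (hl : IsDiPath D' u v l) :
    IsDiPath D u v l ∨ l = u :: (M ++ [v]) := by
  rcases h.cases (by simp) (by simp) hl with hl | ⟨A, B, h1, h2, -, -, rfl⟩
  · exact .inl hl
  · right
    have hA : A = [] := by simpa using isDiPath_self_iff.1 h1
    have hB : B = [] := by simpa using isDiPath_self_iff.1 h2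
    simp [hA, hB]

/-- The new configuration is determined by the old one: the paths that avoid the third terminal are
old, or equal to the added path, and the added path can be prolonged by every direct path. -/
theorem IsEar.describes (h : IsEar D D' u v w M) (huv : u ≠ v) (huw : u ≠ w) (hvw : v ≠ w)
    (hq : pathParity (u :: (M ++ [v])) = q.toNat) (hc : c.Describes D u v w) :
    (c.addPath q).Describes D' u v w := by
  have hear := h.isDiPath
  refine ⟨⟨fun p => ?_, fun p => ?_⟩, ⟨fun p => ?_, fun p => ?_⟩, ?_, ?_, ?_,
    ⟨fun p => ?_, fun p => ?_⟩⟩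
  · simp only [Config.addPath, ParSet.has_union, ParSet.has_single, hc.x01.direct]
    constructor
    · rintro (⟨l, hl, hw, rfl⟩ | rfl)
      · exact ⟨l, hl.mono h.mono, hw, rfl⟩
      · exact ⟨_, hear, by simp [huw.symm, hvw.symm, h.notMem], hq⟩
    · rintro ⟨l, hl, hw, rfl⟩
      rcases h.eq_ear hl with hl | rfl
      · exact .inl ⟨l, hl, hw, rfl⟩
      · exact .inr hq
  · simp only [Config.addPath, ParSet.has_union, ParSet.has_single, hc.x01.total]
    constructor
    · rintro (⟨l, hl, rfl⟩ | rfl)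
      · exact ⟨l, hl.mono h.mono, rfl⟩
      · exact ⟨_, hear, hq⟩
    · rintro ⟨l, hl, rfl⟩
      rcases h.eq_ear hl with hl | rfl
      · exact .inl ⟨l, hl, rfl⟩
      · exact .inr hq
  · simp only [Config.addPath, hc.x02.direct]
    constructor
    · rintro ⟨l, hl, hv, rfl⟩
      exact ⟨l, hl.mono h.mono, hv, rfl⟩
    · rintro ⟨l, hl, hv, rfl⟩
      rcases h.cases (by simp) (by simp) hl with hl | ⟨A, B, -, -, -, -, rfl⟩
      · exact ⟨l, hl, hv, rfl⟩
      · simp at hv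
  · simp only [Config.addPath, ParSet.has_union, ParSet.has_sum, ParSet.has_single, hc.x02.total,
      hc.x12.direct]
    constructor
    · rintro (⟨l, hl, rfl⟩ | ⟨_, _, rfl, rfl, l, hl, hu, rfl⟩)
      · exact ⟨l, hl.mono h.mono, rfl⟩
      · have hl' := hl.mono h.mono
        obtain ⟨B, rfl⟩ := hl.eq_cons
        refine ⟨(u :: M) ++ v :: B, IsDiPath.join hear hl' ?_, ?_⟩
        · intro z hz hz'
          rcases List.mem_cons.1 hz with rfl | hz
          · exact hu hz'
          · exact hu (h.mem v (by simp) w (by simp) _ hl' z hz hz').1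
        · rw [pathParity_split, ← hq]
          rfl
    · rintro ⟨l, hl, rfl⟩
      rcases h.cases (by simp) (by simp) hl with hl | ⟨A, B, h1, h2, -, h4, rfl⟩
      · exact .inl ⟨l, hl, rfl⟩
      · have hA : A = [] := by simpa using isDiPath_self_iff.1 h1
        subst hA
        refine .inr ⟨_, _, ?_, rfl, _, h2, h4, rfl⟩
        rw [← hq]
        exact (pathParity_split (u :: M) B v).symm
  · exact hc.x10.congr fun l => h.path_iff_of_ne (by simp) (by simp) (.inl rfl)
  · exact hc.x12.congr fun l => h.path_iff_of_ne (by simp) (by simp) (.inl rfl)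
  · exact hc.x20.congr fun l => h.path_iff_of_ne (by simp) (by simp) (.inr rfl)
  · simp only [Config.addPath, hc.x21.direct]
    constructor
    · rintro ⟨l, hl, hv, rfl⟩
      exact ⟨l, hl.mono h.mono, hv, rfl⟩
    · rintro ⟨l, hl, hv, rfl⟩
      rcases h.cases (by simp) (by simp) hl with hl | ⟨A, B, -, -, -, -, rfl⟩
      · exact ⟨l, hl, hv, rfl⟩
      · simp at hv
  · simp only [Config.addPath, ParSet.has_union, ParSet.has_sum, ParSet.has_single, hc.x21.total,
      hc.x20.direct]
    constructor
    · rintro (⟨l, hl, rfl⟩ | ⟨_, _, rfl, ⟨l, hl, hv, rfl⟩, rfl⟩)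
      · exact ⟨l, hl.mono h.mono, rfl⟩
      · have hl' := hl.mono h.mono
        obtain ⟨A, rfl⟩ := hl.eq_concat
        refine ⟨A ++ u :: (M ++ [v]), IsDiPath.join hl' hear ?_, ?_⟩
        · intro z hz hz'
          simp only [List.mem_cons, List.mem_append, List.not_mem_nil, or_false] at hz'
          rcases hz' with rfl | hz' | rfl
          · have := hl.2.1
            simp [List.nodup_append] at this
            exact this.2 z hz rfl
          · exact hv (h.mem w (by simp) u (by simp) _ hl' z hz' (by simp [hz])).2
          · exact hv (by simp [hz])
        · rw [pathParity_split, ← hq]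
    · rintro ⟨l, hl, rfl⟩
      rcases h.cases (by simp) (by simp) hl with hl | ⟨A, B, h1, h2, h3, -, rfl⟩
      · exact .inl ⟨l, hl, rfl⟩
      · have hB : B = [] := by simpa using isDiPath_self_iff.1 h2
        subst hB
        refine .inr ⟨_, _, ?_, ⟨_, h1, h3, rfl⟩, rfl⟩
        rw [← hq]
        exact (pathParity_split A (M ++ [v]) u).symm

theorem exists_split_of_not_isChain {R R' : V → V → Prop} (h' : l.IsChain R')
    (h : ¬ l.IsChain R) : ∃ A a b B, l = A ++ a :: b :: B ∧ R' a b ∧ ¬ R a b := by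
  by_contra! hcon
  apply h
  exact List.isChain_iff_forall_rel_of_append_cons_cons.2 fun a b A B hl =>
    hcon A a b B hl (List.isChain_iff_forall_rel_of_append_cons_cons.1 h' hl)

/-- Adding an arc between two terminals. -/
theorem isEar_arc (huv : u ≠ v)
    (h : ∀ a b, D'.Adj a b ↔ D.Adj a b ∨ a = u ∧ b = v) : IsEar D D' u v w [] where
  mono a b hab := (h a b).2 (.inl hab)
  isDiPath := by simp [IsDiPath, huv, h]
  notMem := by simp
  isChain x _ y _ l hl := by
    by_contra! hcon
    obtain ⟨A, a, b, B, rfl, hab, hab'⟩ := exists_split_of_not_isChain hl.1 hcon.1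
    obtain ⟨rfl, rfl⟩ := ((h a b).1 hab).resolve_left hab'
    exact hcon.2 A B rfl
  mem := by simp

theorem IsDiPath.exists_neighbors (hl : IsDiPath D x y l) (hm : m ∈ l) (hx : m ≠ x) (hy : m ≠ y) :
    ∃ A a b B, l = A ++ a :: m :: b :: B ∧ D.Adj a m ∧ D.Adj m b ∧ a ≠ b := by
  obtain ⟨A, B, rfl⟩ := List.append_of_mem hm
  obtain ⟨h1, h2⟩ := hl.split
  rcases List.eq_nil_or_concat' A with rfl | ⟨A, a, rfl⟩
  · exact absurd (by simpa using h1.2.2.1) hx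
  cases B with
  | nil => exact absurd (by simpa using h2.2.2.2) hy
  | cons b B =>
    refine ⟨A, a, b, B, by simp, ?_, ?_, ?_⟩
    · have h3 : (A ++ a :: [m]).IsChain D.Adj := by simpa using h1.1
      simpa using (List.isChain_split.1 h3).2
    · exact (List.isChain_cons_cons.1 h2.1).1
    · rintro rfl
      have := hl.2.1
      simp [List.nodup_append] at this

/-- Adding a path of length two between two terminals `u` and `v`, through a vertex `m` that has no
other neighbours. -/
theorem isEar_path (huv : u ≠ v) (hmu : m ≠ u) (hmv : m ≠ v) (hmw : m ≠ w)
    (h : ∀ a b, D'.Adj a b ↔ D.Adj a b ∨ a = u ∧ b = m ∨ a = m ∧ b = v)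
    (hout : ∀ a, D'.Adj m a → a = u ∨ a = v) (hin : ∀ a, D'.Adj a m → a = u ∨ a = v) :
    IsEar D D' u v w [m] where
  mono a b hab := (h a b).2 (.inl hab)
  isDiPath := by simp [IsDiPath, huv, h, hmu.symm, hmv]
  notMem := by simpa using hmw.symm
  isChain x hx y hy l hl := by
    have hmx : m ≠ x := by rintro rfl; simp [hmu, hmv, hmw] at hx
    have hmy : m ≠ y := by rintro rfl; simp [hmu, hmv, hmw] at hy
    by_contra! hcon
    obtain ⟨A, a, b, B, rfl, hab, hab'⟩ := exists_split_of_not_isChain hl.1 hcon.1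
    have hn := hl.2.1
    have hm : m ∈ A ++ a :: b :: B := by
      rcases ((h a b).1 hab).resolve_left hab' with ⟨rfl, rfl⟩ | ⟨rfl, rfl⟩ <;> simp
    obtain ⟨A', a', b', B', hl', ha', hb', hne⟩ := hl.exists_neighbors hm hmx hmy
    rcases hin a' ha' with rfl | rfl <;> rcases hout b' hb' with rfl | rfl
    · exact hne rfl
    · exact hcon.2 A' B' hl'
    · -- `m` occurs only once, so it would be preceded by `u` and by `v`, or followed by both
      rw [hl'] at hn
      have hn1 : m ∉ A' ++ [a'] ∧ m ∉ b' :: B' := by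
        simp only [List.nodup_append, List.nodup_cons, List.mem_cons] at hn
        simp only [List.mem_append, List.mem_cons, List.not_mem_nil, or_false]
        exact ⟨by rintro (h | h); exacts [hn.2.2 m h m (by simp) rfl, hmv h], hn.2.1.2.1⟩
      rcases ((h a b).1 hab).resolve_left hab' with ⟨ha, hb⟩ | ⟨ha, hb⟩ <;> rw [ha, hb] at hl'
      · have : (A' ++ [a']) ++ m :: (b' :: B') = (A ++ [b']) ++ m :: B := by simpa using hl'.symm
        have h3 := ((List.append_cons_inj_of_notMem hn1.1 hn1.2).1 this).1
        have h4 : a' = b' := by simpa using congrArg List.getLast? h3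
        exact huv h4.symm
      · have : (A' ++ [a']) ++ m :: (b' :: B') = A ++ m :: (a' :: B) := by simpa using hl'.symm
        have h3 := ((List.append_cons_inj_of_notMem hn1.1 hn1.2).1 this).2.2
        exact huv (List.cons.inj h3).1
    · exact hne rfl
  mem x hx y hy l hl z hz hzl := by
    obtain rfl := List.mem_singleton.1 hz
    have hmx : z ≠ x := by rintro rfl; simp [hmu, hmv, hmw] at hx
    have hmy : z ≠ y := by rintro rfl; simp [hmu, hmv, hmw] at hy
    obtain ⟨A, a, b, B, rfl, ha, hb, hne⟩ := hl.exists_neighbors hzl hmx hmy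
    rcases hin a ha with rfl | rfl <;> rcases hout b hb with rfl | rfl <;> simp at hne ⊢

end Ears

/-! ### Enumeration of paths -/

section Parities

variable {V : Type*}

/-- The set of parities of the paths in a list that satisfy `P`. -/
def paritiesOf (L : List (List V)) (P : List V → Bool) : ParSet :=
  (L.any fun l => l.length % 2 == 1 && P l, L.any fun l => l.length % 2 == 0 && P l)

theorem has_paritiesOf {L : List (List V)} (hL : [] ∉ L) {P : List V → Bool} {p : ZMod 2} :
    (paritiesOf L P).Has p ↔ ∃ l ∈ L, P l = true ∧ pathParity l = p := by
  have key : ∀ l : List V, l ≠ [] → (pathParity l = 0 ↔ l.length % 2 = 1) ∧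
      (pathParity l = 1 ↔ l.length % 2 = 0) := by
    intro l hl
    have h1 := List.length_pos_iff.2 hl
    constructor
    · rw [pathParity, ZMod.natCast_eq_zero_iff]
      omega
    · have : (1 : ZMod 2) = ((1 : ℕ) : ZMod 2) := by simp
      rw [pathParity, this, ZMod.natCast_eq_natCast_iff, Nat.ModEq]
      omega
  rcases (by decide : ∀ p : ZMod 2, p = 0 ∨ p = 1) p with rfl | rfl
  · simp only [ParSet.Has, paritiesOf, if_true, List.any_eq_true, Bool.and_eq_true, beq_iff_eq]
    refine exists_congr fun l => and_congr_right fun hl => ?_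
    rw [(key l (by rintro rfl; exact hL hl)).1, and_comm]
  · simp only [ParSet.Has, paritiesOf, one_ne_zero, if_false, List.any_eq_true, Bool.and_eq_true,
      beq_iff_eq]
    refine exists_congr fun l => and_congr_right fun hl => ?_
    rw [(key l (by rintro rfl; exact hL hl)).2, and_comm]

end Parities

section Enumeration

variable {V : Type*} [DecidableEq V] {A : List (V × V)} {D : Digraph V} {u v w : V} {l : List V}

/-- The prolongations of a path by one of the arcs in the list `A`. Paths are written backwards. -/
def prolong (A : List (V × V)) (l : List V) : List (List V) :=
  A.filterMap fun a => if l.head? = some a.1 ∧ a.2 ∉ l then some (a.2 :: l) else none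

/-- The paths in `L`, their prolongations, and so on, up to `n` generations. -/
def prolongations (A : List (V × V)) : ℕ → List (List V) → List (List V)
  | 0, _ => []
  | n + 1, L => L ++ prolongations A n (L.flatMap (prolong A))

/-- The digraph with the arcs in the list `A`. -/
def digraphOf (A : List (V × V)) : Digraph V where
  Adj a b := (a, b) ∈ A

theorem mem_prolong {k : List V} : k ∈ prolong A l ↔
    ∃ a b, (a, b) ∈ A ∧ l.head? = some a ∧ b ∉ l ∧ k = b :: l := by
  simp only [prolong, List.mem_filterMap, Prod.exists, Option.ite_none_right_eq_some,
    Option.some.injEq, and_assoc, eq_comm (a := k)]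

/-- The `n`-th generation consists of the paths with `n` arcs, written backwards. -/
theorem mem_iterate_prolong (n : ℕ) (k : List V) :
    k ∈ (fun L => L.flatMap (prolong A))^[n] [[u]] ↔
      k.IsChain (fun a b => (b, a) ∈ A) ∧ k.Nodup ∧ k.getLast? = some u ∧ k.length = n + 1 := by
  induction n generalizing k with
  | zero =>
    simp only [Function.iterate_zero, id, List.mem_singleton, zero_add]
    constructor
    · rintro rfl
      simp
    · rintro ⟨-, -, h1, h2⟩
      obtain ⟨a, rfl⟩ := List.length_eq_one_iff.1 h2
      simpa using h1
  | succ n ih =>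
    rw [Function.iterate_succ_apply', List.mem_flatMap]
    constructor
    · rintro ⟨l, hl, hk⟩
      obtain ⟨a, b, hab, ha, hb, rfl⟩ := mem_prolong.1 hk
      obtain ⟨h1, h2, h3, h4⟩ := (ih l).1 hl
      obtain ⟨l', rfl⟩ := List.head?_eq_some_iff.1 ha
      exact ⟨List.isChain_cons_cons.2 ⟨hab, h1⟩, List.nodup_cons.2 ⟨hb, h2⟩,
        by simpa [List.getLast?_cons] using h3, by simpa using h4⟩
    · rintro ⟨h1, h2, h3, h4⟩
      match k, h4 with
      | b :: a :: l, h4 =>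
        refine ⟨a :: l,
          (ih _).2 ⟨(List.isChain_cons_cons.1 h1).2, (List.nodup_cons.1 h2).2, ?_, ?_⟩,
          mem_prolong.2 ⟨a, b, (List.isChain_cons_cons.1 h1).1, rfl, (List.nodup_cons.1 h2).1, rfl⟩⟩
        · simpa [List.getLast?_cons] using h3
        · simpa using h4

theorem mem_prolongations (n : ℕ) (L : List (List V)) :
    l ∈ prolongations A n L ↔ ∃ i < n, l ∈ (fun L => L.flatMap (prolong A))^[i] L := by
  induction n generalizing L with
  | zero => simp [prolongations]
  | succ n ih =>
    rw [prolongations, List.mem_append, ih]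
    constructor
    · rintro (h | ⟨i, hi, h⟩)
      · exact ⟨0, by omega, h⟩
      · exact ⟨i + 1, by omega, h⟩
    · rintro ⟨_ | i, hi, h⟩
      · exact .inl h
      · exact .inr ⟨i, by omega, h⟩

theorem mem_prolongations_iff [Fintype V] :
    l ∈ prolongations A (Fintype.card V) [[u]] ↔ ∃ v, IsDiPath (digraphOf A) u v l.reverse := by
  simp only [mem_prolongations, mem_iterate_prolong, IsDiPath, List.isChain_reverse,
    List.nodup_reverse, List.head?_reverse, List.getLast?_reverse]
  constructor
  · rintro ⟨i, -, h1, h2, h3, h4⟩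
    cases l with
    | nil => simp at h4
    | cons a l => exact ⟨a, h1, h2, h3, rfl⟩
  · rintro ⟨v, h1, h2, h3, h4⟩
    have h5 := h2.length_le_card
    cases l with
    | nil => simp at h4
    | cons a l => exact ⟨l.length, by simpa using h5, h1, h2, h3, rfl⟩

/-- The link from the last vertex of the (backward) paths in the list `L` to the vertex `v`. -/
def linkOf (L : List (List V)) (v w : V) : Link where
  direct := paritiesOf L fun l => l.head? == some v && !l.contains w
  total := paritiesOf L fun l => l.head? == some v

theorem describes_linkOf [Fintype V] (A : List (V × V)) (u v w : V) :
    (linkOf (prolongations A (Fintype.card V) [[u]]) v w).Describes (digraphOf A) u v w := by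
  have hnil : [] ∉ prolongations A (Fintype.card V) [[u]] := by
    rw [mem_prolongations_iff]
    simp [IsDiPath]
  have key : ∀ l, (l ∈ prolongations A (Fintype.card V) [[u]] ∧ l.head? = some v) ↔
      IsDiPath (digraphOf A) u v l.reverse := by
    intro l
    rw [mem_prolongations_iff]
    constructor
    · rintro ⟨⟨v', h⟩, hv⟩
      have h1 := h.2.2.2
      rw [List.getLast?_reverse, hv] at h1
      rwa [Option.some.inj h1]
    · intro h
      exact ⟨⟨v, h⟩, by simpa using h.2.2.2⟩
  refine ⟨fun p => ?_, fun p => ?_⟩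
  · rw [linkOf, has_paritiesOf hnil]
    constructor
    · rintro ⟨l, hl, h1, rfl⟩
      simp only [Bool.and_eq_true, beq_iff_eq, Bool.not_eq_true', List.contains_eq_mem,
        decide_eq_false_iff_not] at h1
      exact ⟨_, (key l).1 ⟨hl, h1.1⟩, by simpa using h1.2, pathParity_reverse l⟩
    · rintro ⟨l, hl, hw, rfl⟩
      obtain ⟨h1, h2⟩ := (key l.reverse).2 (by simpa using hl)
      exact ⟨_, h1, by simpa [hw] using h2, pathParity_reverse l⟩
  · rw [linkOf, has_paritiesOf hnil]
    constructor
    · rintro ⟨l, hl, h1, rfl⟩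
      exact ⟨_, (key l).1 ⟨hl, by simpa using h1⟩, pathParity_reverse l⟩
    · rintro ⟨l, hl, rfl⟩
      obtain ⟨h1, h2⟩ := (key l.reverse).2 (by simpa using hl)
      exact ⟨_, h1, by simpa using h2, pathParity_reverse l⟩

/-- The configuration of the digraph with arc list `A`, found by listing all paths that start in a
terminal. -/
def configOf [Fintype V] (A : List (V × V)) (u v w : V) : Config :=
  let pu := prolongations A (Fintype.card V) [[u]]
  let pv := prolongations A (Fintype.card V) [[v]]
  let pw := prolongations A (Fintype.card V) [[w]]
  ⟨linkOf pu v w, linkOf pu w v, linkOf pv u w, linkOf pv w u, linkOf pw u v, linkOf pw v u⟩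

theorem describes_configOf [Fintype V] (A : List (V × V)) (u v w : V) :
    (configOf A u v w).Describes (digraphOf A) u v w :=
  ⟨describes_linkOf A u v w, describes_linkOf A u w v, describes_linkOf A v u w,
    describes_linkOf A v w u, describes_linkOf A w u v, describes_linkOf A w v u⟩

end Enumeration

/-! ### Straight line drawings -/

section Drawing

variable {V : Type*}

/-- The orientation determinant of the points `a`, `b`, `c` of the plane. -/
def orient (a b c : ℤ × ℤ) : ℤ :=
  (b.1 - a.1) * (c.2 - a.2) - (b.2 - a.2) * (c.1 - a.1)

/-- A lattice point as a point of the Euclidean plane. -/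
noncomputable def toPlane (a : ℤ × ℤ) : Plane := !₂[(a.1 : ℝ), (a.2 : ℝ)]

/-- The affine function that is `orient a b` on lattice points. -/
noncomputable def orientReal (a b : ℤ × ℤ) (z : Plane) : ℝ :=
  (b.1 - a.1) * (z 1 - a.2) - (b.2 - a.2) * (z 0 - a.1)

theorem orientReal_toPlane (a b c : ℤ × ℤ) : orientReal a b (toPlane c) = orient a b c := by
  simp [orientReal, toPlane, orient]

theorem toPlane_injective : Function.Injective toPlane := by
  intro a b h
  have h0 := congrArg (fun z : Plane => z 0) h
  have h1 := congrArg (fun z : Plane => z 1) h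
  simp only [toPlane] at h0 h1
  exact Prod.ext (by simpa using h0) (by simpa using h1)

theorem orientReal_of_mem_segment {a b c d : ℤ × ℤ} {z : Plane}
    (hz : z ∈ segment ℝ (toPlane c) (toPlane d)) :
    ∃ s t : ℝ, 0 ≤ s ∧ 0 ≤ t ∧ s + t = 1 ∧ z = s • toPlane c + t • toPlane d ∧
      orientReal a b z = s * orient a b c + t * orient a b d := by
  obtain ⟨s, t, hs, ht, hst, rfl⟩ := hz
  refine ⟨s, t, hs, ht, hst, rfl, ?_⟩
  obtain rfl : s = 1 - t := by linarith
  simp [orientReal, toPlane, orient]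
  ring

theorem orientReal_eq_zero {a b : ℤ × ℤ} {z : Plane}
    (hz : z ∈ segment ℝ (toPlane a) (toPlane b)) : orientReal a b z = 0 := by
  obtain ⟨s, t, -, -, -, -, h⟩ := orientReal_of_mem_segment (a := a) (b := b) hz
  rw [h]
  simp [orient]
  right
  ring

/-- Two segments are disjoint if the end points of one of them lie strictly on one side of the line
through the other one. -/
theorem disjoint_segment {a b c d : ℤ × ℤ} (h : 0 < orient a b c * orient a b d) :
    Disjoint (segment ℝ (toPlane a) (toPlane b)) (segment ℝ (toPlane c) (toPlane d)) := by
  rw [Set.disjoint_left]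
  intro z hz hz'
  obtain ⟨s, t, hs, ht, hst, -, h'⟩ := orientReal_of_mem_segment (a := a) (b := b) hz'
  rw [orientReal_eq_zero hz] at h'
  have hR : (0 : ℝ) < orient a b c * orient a b d := by exact_mod_cast h
  have h1 : s * (orient a b c : ℝ) ^ 2 + t * (orient a b c * orient a b d) = 0 := by
    linear_combination -(orient a b c : ℝ) * h'
  have h2 : (0 : ℝ) < (orient a b c : ℝ) ^ 2 := by
    have : (orient a b c : ℝ) ≠ 0 := by rintro h0; simp [h0] at hR
    positivity
  rcases hs.eq_or_lt with rfl | hs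
  · have : t = 1 := by linarith
    rw [this] at h1
    linarith
  · have := mul_pos hs h2
    have := mul_nonneg ht hR.le
    linarith

theorem segment_inter_segment {a b c : ℤ × ℤ} (h : orient a b c ≠ 0) :
    segment ℝ (toPlane a) (toPlane b) ∩ segment ℝ (toPlane a) (toPlane c) ⊆ {toPlane a} := by
  rintro z ⟨hz, hz'⟩
  obtain ⟨s, t, hs, ht, hst, rfl, h'⟩ := orientReal_of_mem_segment (a := a) (b := b) hz'
  rw [orientReal_eq_zero hz] at h'
  have h0 : orient a b a = 0 := by simp [orient]
  have hR : (orient a b c : ℝ) ≠ 0 := by exact_mod_cast h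
  have ht0 : t = 0 := by simpa [h0, hR] using h'.symm
  have hs1 : s = 1 := by linarith
  simp [ht0, hs1]

theorem orient_eq_zero_of_mem_segment {a b c : ℤ × ℤ}
    (h : toPlane c ∈ segment ℝ (toPlane a) (toPlane b)) : orient a b c = 0 := by
  have := orientReal_eq_zero h
  rw [orientReal_toPlane] at this
  exact_mod_cast this

theorem isArc_segment {x y : Plane} (h : x ≠ y) : IsArc (segment ℝ x y) x y := by
  refine ⟨AffineMap.lineMap x y, ?_, ?_, by simp, by simp, (segment_eq_image_lineMap ℝ x y).symm⟩
  · exact AffineMap.lineMap_continuous.continuousOn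
  · exact (AffineMap.lineMap_injective ℝ h).injOn

/-- Lattice points `p v` such that the segments between the points of adjacent vertices of the
graph with adjacency relation `E` do not cross. -/
structure IsStraightDrawing (p : V → ℤ × ℤ) (E : V → V → Prop) : Prop where
  injective : Function.Injective p
  general : ∀ a b c, a ≠ b → a ≠ c → b ≠ c → orient (p a) (p b) (p c) ≠ 0
  noncrossing : ∀ a b c d, E a b → E c d → a ≠ c → a ≠ d → b ≠ c → b ≠ d →
    0 < orient (p a) (p b) (p c) * orient (p a) (p b) (p d) ∨
      0 < orient (p c) (p d) (p a) * orient (p c) (p d) (p b)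

variable {p : V → ℤ × ℤ} {E : V → V → Prop} {G : SimpleGraph V}

theorem convexHull_image_sym2 (p : V → ℤ × ℤ) (u v : V) :
    convexHull ℝ ((fun v => toPlane (p v)) '' {w | w ∈ s(u, v)}) =
      segment ℝ (toPlane (p u)) (toPlane (p v)) := by
  have : {w | w ∈ s(u, v)} = {u, v} := by
    ext w
    simp
  rw [this, Set.image_pair, convexHull_pair]

/-- The drawing of a subgraph by straight segments. -/
noncomputable def IsStraightDrawing.planeDrawing (h : IsStraightDrawing p E)
    (hG : ∀ a b, G.Adj a b → E a b) : PlaneDrawing G where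
  pos v := toPlane (p v)
  arc e := convexHull ℝ ((fun v => toPlane (p v)) '' {w | w ∈ e})
  pos_injective := toPlane_injective.comp h.injective
  isArc u v huv := by
    rw [convexHull_image_sym2]
    exact isArc_segment fun h' => huv.ne (h.injective (toPlane_injective h'))
  vertex_on_arc e he w hw := by
    induction e with | _ u v
    rw [convexHull_image_sym2] at hw
    by_contra hwe
    simp only [Sym2.mem_iff, not_or] at hwe
    exact h.general u v w he.ne (Ne.symm hwe.1) (Ne.symm hwe.2)
      (orient_eq_zero_of_mem_segment hw)
  arc_inter e he e' he' hne := by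
    -- two edges that share the vertex `a`
    have key : ∀ a b c, G.Adj a b → G.Adj a c → b ≠ c →
        segment ℝ (toPlane (p a)) (toPlane (p b)) ∩ segment ℝ (toPlane (p a)) (toPlane (p c)) ⊆
          Set.range fun v => toPlane (p v) := by
      intro a b c hab hac hbc
      refine (segment_inter_segment (h.general a b c hab.ne hac.ne hbc)).trans ?_
      rintro _ rfl
      exact ⟨a, rfl⟩
    induction e with | _ a b
    induction e' with | _ c d
    rw [convexHull_image_sym2, convexHull_image_sym2]
    rw [SimpleGraph.mem_edgeSet] at he he'
    by_cases hac : a = c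
    · subst hac
      exact key a b d he he' (by rintro rfl; exact hne rfl)
    by_cases had : a = d
    · subst had
      rw [segment_symm ℝ (toPlane (p c))]
      exact key a b c he he'.symm (by rintro rfl; exact hne Sym2.eq_swap)
    by_cases hbc : b = c
    · subst hbc
      rw [segment_symm ℝ (toPlane (p a))]
      exact key b a d he.symm he' had
    by_cases hbd : b = d
    · subst hbd
      rw [segment_symm ℝ (toPlane (p a)), segment_symm ℝ (toPlane (p c))]
      exact key b a c he.symm he'.symm hac
    rcases h.noncrossing a b c d (hG _ _ he) (hG _ _ he') hac had hbc hbd with h' | h'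
    · rw [(disjoint_segment h').inter_eq]
      exact Set.empty_subset _
    · rw [(disjoint_segment h').symm.inter_eq]
      exact Set.empty_subset _

/-- The open region below the standard parabola. -/
def belowParabola : Set Plane := {z | z 1 < z 0 ^ 2}

theorem isPreconnected_belowParabola : IsPreconnected belowParabola := by
  have h : belowParabola = (fun q : ℝ × ℝ => (!₂[q.1, q.1 ^ 2 + q.2] : Plane)) ''
      (Set.univ ×ˢ Set.Iio 0) := by
    ext z
    simp only [belowParabola, Set.mem_ofPred_eq, Set.mem_image, Set.mem_prod, Set.mem_univ,
      true_and, Set.mem_Iio, Prod.exists]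
    constructor
    · intro hz
      refine ⟨z 0, z 1 - z 0 ^ 2, by linarith, ?_⟩
      ext i
      fin_cases i <;> simp
    · rintro ⟨a, b, hb, rfl⟩
      simpa using hb
  rw [h]
  refine (isPreconnected_univ.prod isPreconnected_Iio).image _ (Continuous.continuousOn ?_)
  fun_prop

theorem mem_closure_belowParabola {z : Plane} (hz : z 1 = z 0 ^ 2) :
    z ∈ closure belowParabola := by
  have h1 : Filter.Tendsto (fun t : ℝ => (!₂[z 0, z 1 - t] : Plane)) (nhdsWithin 0 (Set.Ioi 0))
      (nhds z) := by
    have h2 : Continuous fun t : ℝ => (!₂[z 0, z 1 - t] : Plane) := by fun_prop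
    have h3 := (h2.tendsto 0).mono_left (nhdsWithin_le_nhds (s := Set.Ioi 0))
    have h4 : (!₂[z 0, z 1 - 0] : Plane) = z := by
      ext i
      fin_cases i <;> simp
    rwa [h4] at h3
  refine mem_closure_of_tendsto h1 ?_
  filter_upwards [self_mem_nhdsWithin] with t ht
  have : (0 : ℝ) < t := ht
  simp only [belowParabola, Set.mem_ofPred_eq]
  simp
  linarith

/-- In a straight line drawing above the standard parabola, all vertices on the parabola lie on the
boundary of one face. -/
theorem IsStraightDrawing.exists_face (h : IsStraightDrawing p E)
    (hG : ∀ a b, G.Adj a b → E a b) (hp : ∀ v, (p v).1 ^ 2 ≤ (p v).2) :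
    ∃ (Δ : PlaneDrawing G) (F : Set Plane), Δ.IsFace F ∧
      ∀ v, (p v).2 = (p v).1 ^ 2 → Δ.pos v ∈ frontier F := by
  have hp' : ∀ v, toPlane (p v) ∈ belowParabolaᶜ := by
    intro v
    simp only [belowParabola, Set.mem_compl_iff, Set.mem_ofPred_eq, not_lt, toPlane]
    simpa using (by exact_mod_cast hp v : ((p v).1 : ℝ) ^ 2 ≤ (p v).2)
  have hconv : Convex ℝ belowParabolaᶜ := by
    intro x hx y hy s t hs ht hst
    simp only [belowParabola, Set.mem_compl_iff, Set.mem_ofPred_eq, not_lt] at hx hy ⊢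
    obtain rfl : s = 1 - t := by linarith
    simp only [PiLp.add_apply, PiLp.smul_apply, smul_eq_mul]
    nlinarith [mul_nonneg (mul_nonneg hs ht) (sq_nonneg (x 0 - y 0)),
      mul_le_mul_of_nonneg_left hx hs, mul_le_mul_of_nonneg_left hy ht]
  let Δ := h.planeDrawing hG
  have hsub : belowParabola ⊆ Δ.supportᶜ := by
    rw [Set.subset_compl_comm]
    refine Set.union_subset ?_ (Set.iUnion₂_subset fun e _ => ?_)
    · rintro _ ⟨v, rfl⟩
      exact hp' v
    · refine convexHull_min ?_ hconv
      rintro _ ⟨v, -, rfl⟩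
      exact hp' v
  have hz : (!₂[0, -1] : Plane) ∈ belowParabola := by simp [belowParabola]
  refine ⟨Δ, connectedComponentIn Δ.supportᶜ !₂[0, -1], ⟨_, hsub hz, rfl⟩, fun v hv => ⟨?_, ?_⟩⟩
  · refine closure_mono (isPreconnected_belowParabola.subset_connectedComponentIn hz hsub)
      (mem_closure_belowParabola ?_)
    have : ((p v).2 : ℝ) = ((p v).1 : ℝ) ^ 2 := by exact_mod_cast hv
    simpa [Δ, IsStraightDrawing.planeDrawing, toPlane] using this
  · intro hmem
    exact connectedComponentIn_subset _ _ (interior_subset hmem) (.inl ⟨v, rfl⟩)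

end Drawing

/-! ### The plane graph and the table of networks -/

section PlaneGraph

theorem orient_swap (a b c : ℤ × ℤ) : orient b a c = - orient a b c := by
  simp only [orient]
  ring

theorem isStraightDrawing_of_edges {V : Type*} {p : V → ℤ × ℤ} {L : List (V × V)}
    (hp : Function.Injective p)
    (hgen : ∀ a b c, a ≠ b → a ≠ c → b ≠ c → orient (p a) (p b) (p c) ≠ 0)
    (h : ∀ e ∈ L, ∀ f ∈ L, e.1 ≠ f.1 → e.1 ≠ f.2 → e.2 ≠ f.1 → e.2 ≠ f.2 →
      0 < orient (p e.1) (p e.2) (p f.1) * orient (p e.1) (p e.2) (p f.2) ∨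
        0 < orient (p f.1) (p f.2) (p e.1) * orient (p f.1) (p f.2) (p e.2)) :
    IsStraightDrawing p fun a b => (a, b) ∈ L ∨ (b, a) ∈ L where
  injective := hp
  general := hgen
  noncrossing := by
    rintro a b c d (hab | hab) (hcd | hcd) hac had hbc hbd
    · exact h _ hab _ hcd hac had hbc hbd
    · have := h _ hab _ hcd had hac hbd hbc
      simpa only [orient_swap (p c) (p d), neg_mul_neg,
        mul_comm (orient (p a) (p b) (p d))] using this
    · have := h _ hab _ hcd hbc hbd hac had
      simpa only [orient_swap (p a) (p b), neg_mul_neg,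
        mul_comm (orient (p c) (p d) (p b))] using this
    · have := h _ hab _ hcd hbd hbc had hac
      simpa only [orient_swap (p a) (p b), orient_swap (p c) (p d), neg_mul_neg,
        mul_comm (orient (p c) (p d) (p b)), mul_comm (orient (p a) (p b) (p d))] using this

/-- The edges of the plane graph `planePoint` between the three terminals `0`, `1`, `2` and the
vertices `3`, `4`, `5`: each pair of terminals is joined by an edge and by a path of length two. -/
def sideEdges : List (Fin 18 × Fin 18) :=
  [(0, 1), (0, 3), (3, 1), (0, 2), (0, 4), (4, 2), (1, 2), (1, 5), (5, 2)]

/-- The other edges of the plane graph. The vertices `7`, `8`, `9`, `10` form the rim of a wheel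
with centre `6`, and each of the vertices from `11` on subdivides a copy of one of the edges. -/
def coreEdges : List (Fin 18 × Fin 18) :=
  [(0, 10), (0, 7), (2, 8), (2, 9), (1, 7), (1, 8), (7, 8), (8, 9), (9, 10), (10, 7), (6, 7),
   (6, 8), (6, 9), (6, 10), (0, 9), (0, 11), (11, 10), (0, 12), (12, 7), (2, 13), (13, 8), (2, 14),
   (14, 9), (1, 15), (15, 7), (8, 16), (16, 9), (9, 17), (17, 10)]

/-- The adjacency relation of the plane graph. -/
def PlaneAdj (a b : Fin 18) : Prop :=
  (a, b) ∈ sideEdges ++ coreEdges ∨ (b, a) ∈ sideEdges ++ coreEdges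

instance : DecidableRel PlaneAdj := fun _ _ => inferInstanceAs (Decidable (_ ∨ _))

/-- The positions of the vertices of the plane graph. The terminals lie on the parabola `y = x²`,
the other vertices above it. -/
def planePoint : Fin 18 → ℤ × ℤ :=
  ![(-20, 400), (0, 0), (20, 400), (-12, 186), (-3, 408), (12, 200), (-1, 304), (-7, 234), (2, 278),
    (0, 327), (-4, 288), (-14, 372), (-13, 318), (10, 361), (10, 371), (-3, 126), (2, 307),
    (-6, 310)]

theorem isStraightDrawing_planePoint : IsStraightDrawing planePoint PlaneAdj :=
  isStraightDrawing_of_edges (by decide +kernel) (by decide +kernel) (by decide +kernel)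

end PlaneGraph

section Realization

/-- The configuration `c` is realized by an orientation of a subgraph of the plane graph, opposite
arcs being allowed. -/
def Config.Planar (c : Config) : Prop :=
  ∃ D : Digraph (Fin 18), (∀ a b, D.Adj a b → PlaneAdj a b) ∧
    ∃ τ : Fin 3 ↪ Fin 18, (∀ i, τ i < 3) ∧ c.Describes D (τ 0) (τ 1) (τ 2)

/-- The entries of a list at the positions of the ones in the binary representation of a number. -/
def select {α : Type*} : List α → ℕ → List α
  | [], _ => []
  | a :: l, n => if n % 2 = 1 then a :: select l (n / 2) else select l (n / 2)

/-- The possible arcs along the edges in `coreEdges`. -/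
def coreArcs : List (Fin 18 × Fin 18) := coreEdges.flatMap fun e => [e, e.swap]

/-- A link as a number below 16. -/
def Link.code (x : Link) : ℕ :=
  x.direct.1.toNat + 2 * (x.direct.2.toNat + 2 * (x.total.1.toNat + 2 * x.total.2.toNat))

/-- A configuration as a number with one hexadecimal digit for each of its links. -/
def Config.code (c : Config) : ℕ :=
  c.x01.code + 16 * (c.x02.code + 16 * (c.x10.code + 16 * (c.x12.code + 16 * (c.x20.code +
    16 * c.x21.code))))

theorem Link.code_lt (x : Link) : x.code < 16 := by
  obtain ⟨⟨a, b⟩, ⟨c, d⟩⟩ := x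
  revert a b c d; decide

theorem Link.code_injective : Function.Injective Link.code := by
  rintro ⟨⟨a, b⟩, ⟨c, d⟩⟩ ⟨⟨a', b'⟩, ⟨c', d'⟩⟩
  revert a b c d a' b' c' d'; decide

theorem Config.code_injective : Function.Injective Config.code := by
  intro c d h
  have := c.x01.code_lt; have := c.x02.code_lt; have := c.x10.code_lt
  have := c.x12.code_lt; have := c.x20.code_lt; have := c.x21.code_lt
  have := d.x01.code_lt; have := d.x02.code_lt; have := d.x10.code_lt
  have := d.x12.code_lt; have := d.x20.code_lt; have := d.x21.code_lt
  simp only [Config.code] at h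
  ext1 <;> apply Link.code_injective <;> omega

/-- The images of a configuration under permutations of the terminals and reversal. -/
def Config.images (c : Config) : List Config :=
  let l := [c, c.rotate, c.rotate.rotate]
  let m := l ++ l.map Config.swap
  m ++ m.map Config.reverse

/-- The feasible configurations from which no path between two terminals can be removed, up to
permutations of the terminals and reversal. Each of them is given by the least code of its images,
and comes with a set of arcs, as a subset of `coreArcs`, that realizes one of the images. -/
def coreTable : List (ℕ × ℕ) :=
  [(0, 0), (20570, 75503890), (20645, 11302979801992192), (21925, 11261758585635137),
   (23130, 85905645880), (24560, 2754148287088), (41130, 268470368), (43690, 705061831323940),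
   (45040, 1058365841085184), (4545189, 5695556137552136), (4564309, 353218653602340),
   (4580693, 180539997223461444), (4584869, 706522684359952), (4871514, 180165981232994592),
   (4893354, 2834678425112), (4909738, 90467913639395904), (4912554, 749042571763970),
   (5592490, 703859240481844), (5592495, 705078150304032), (5593690, 351859971199536),
   (5593694, 1546188240420), (5593738, 2920577771028), (5593765, 11302980338863168),
   (5593773, 10738174401), (5593775, 11283915266602496), (5593818, 6335936291942676),
   (5593822, 725688781640096), (5593829, 45360362055176), (5593845, 21991047353224),
   (5594718, 397199113106017), (5594797, 270216154810427078), (5594799, 43980625090838),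
   (5594842, 5982889752660000), (5594846, 351844065739414), (5594869, 703687448078652),
   (5595048, 101684210129979944), (5595050, 4295504189700), (5595053, 6355349550441604),
   (5595055, 775038659), (5595125, 317737400), (5595130, 281496967012686123),
   (5595132, 11613591837690514), (5595134, 352106794150546), (5612970, 5630874729090176),
   (5613738, 373839998239360), (5614250, 1057077350903844), (5614314, 180188137696592704),
   (5614330, 180517825013617284), (5615605, 16891248221668928), (5615610, 11965435505542473),
   (5615612, 5695470241941126), (5615614, 6004714052032642), (5626586, 46740351490368),
   (5790426, 180495829352907465), (5810938, 90093983117878930), (5922221, 95724867709835680),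
   (5922285, 5652950206716323), (5922298, 65971004582914), (5922810, 180539826093228608),
   (5922812, 707897073894672), (5922813, 24825457971985), (5940570, 95705701692999168),
   (5940650, 703945146147168), (5940655, 24911116510724), (5941933, 90072003553315936),
   (5941935, 706693928328208), (5942010, 5676239884946448), (5942957, 420574090827793),
   (5942959, 705239238592800), (5943213, 395824598811218), (5943215, 6337310984515968),
   (5943290, 68735810504192), (5943292, 102100735654651018), (5943293, 354593075252820),
   (5952941, 17262333092966948), (5954989, 276198872454800006), (5958319, 4295242070272),
   (5961055, 1055617339921464), (5961135, 5985467264145922), (5962335, 6333193033073760),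
   (5962413, 46730075735616), (5962415, 5633623123020034), (5962847, 6399158211093638),
   (5962927, 11984687583224965), (5963103, 95723482583541382), (5963183, 6399254857417729),
   (6119134, 728426722439574), (6119422, 397371353614401), (6139902, 180495915258259049),
   (6150750, 11654995457558544), (6158943, 5673480302957382), (6159023, 11259095705920361),
   (6223199, 11305986011647056), (6223279, 90073367144834659), (6250495, 1099683982483477),
   (6269615, 351930258053784), (6269647, 5673566445012584), (6269679, 180539809818577481),
   (6270431, 186521163273672985), (6270703, 24739643131537), (6270975, 12358682504360132),
   (6285999, 6004708764582560), (6288735, 95701508227209616), (6288815, 197736171408433554),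
   (6288847, 181199521633100435), (6290095, 6377178285782081), (6290127, 91152278837694722),
   (11184810, 24739150112265), (11184814, 354593176052241), (11184878, 5981429236271810),
   (11185838, 6334733969568036), (11185898, 95723488220027168), (11185902, 376583269847689),
   (11186170, 185774859287775522), (11186172, 5651661833935300), (11186174, 180517829792352297),
   (11382237, 90470576601170516), (11382781, 6378628544731400), (11448046, 90470662417691224),
   (11448318, 373920664430120), (11463342, 45526921787684), (11467439, 95704337906664264),
   (11513855, 16932489880722500), (11532975, 1121507353167882), (11533007, 192461274852168003)]

theorem coreTable_correct : ∀ r ∈ coreTable,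
    ∃ c ∈ (configOf (select coreArcs r.2) (0 : Fin 18) 1 2).images, c.code = r.1 := by
  decide +kernel

end Realization

/-! ### Completeness of the table -/

section Coverage

/-- Intersection of sets of parities. -/
def ParSet.inter (s t : ParSet) : ParSet := (s.1 && t.1, s.2 && t.2)

/-- The set `s` without the parity `q`. -/
def ParSet.erase (q : Bool) (s : ParSet) : ParSet := (s.1 && q, s.2 && !q)

/-- The number of elements of a set of parities. -/
def ParSet.card (s : ParSet) : ℕ := s.1.toNat + s.2.toNat

/-- The total set of a link with direct set `d` and set of sums `s`, if the total set was `t` before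
the removal of a path. -/
def ParSet.restrict (d t s : ParSet) : ParSet :=
  if d = (false, false) then s else d.union (t.inter s)

/-- A candidate for a configuration from which `c` arises by adding a path of parity `q` from the
first to the second terminal. -/
def Config.removePath (q : Bool) (c : Config) : Config :=
  let d := c.x01.direct.erase q
  { c with
    x01 := ⟨d, d.restrict c.x01.total (c.x02.direct.sum c.x21.direct)⟩
    x02 := ⟨c.x02.direct, c.x02.direct.restrict c.x02.total (d.sum c.x12.direct)⟩
    x21 := ⟨c.x21.direct, c.x21.direct.restrict c.x21.total (c.x20.direct.sum d)⟩ }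

/-- The number of direct parities in a configuration. -/
def Config.size (c : Config) : ℕ :=
  c.x01.direct.card + c.x02.direct.card + c.x10.direct.card + c.x12.direct.card +
    c.x20.direct.card + c.x21.direct.card

/-- A set of parities is contained in another one. -/
def ParSet.subset (s t : ParSet) : Bool := (!s.1 || t.1) && (!s.2 || t.2)

/-- A criterion for `c` to arise from `c.removePath q` by adding a path of parity `q` from the first
to the second terminal: `q` is a direct parity, the old total sets already contain everything that
the new path contributes, and no total parity between the first two terminals is lost. -/
def Config.reducibleBy (q : Bool) (c : Config) : Bool :=
  (bif q then c.x01.direct.2 else c.x01.direct.1) &&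
    ((c.x01.direct.1 && c.x01.direct.2) ||
      (c.x02.direct.sum c.x21.direct).subset c.x01.total) &&
    ((ParSet.single q).sum c.x12.direct).subset c.x02.total &&
    (c.x20.direct.sum (.single q)).subset c.x21.total

/-- A configuration is settled if, up to symmetry, it is reducible or occurs in the table. (The
table contains the least codes; the comparison of codes only saves useless searches.) -/
def Config.settled (c : Config) : Bool :=
  c.images.any (fun d => d.reducibleBy false || d.reducibleBy true) ||
    c.images.any fun d => (c.images.all fun e => Nat.ble d.code e.code) &&
      coreTable.any fun r => Nat.beq r.1 d.code

/-- `f` holds for all sets of parities. -/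
def ParSet.all (f : ParSet → Bool) : Bool :=
  f (false, false) && f (true, false) && f (false, true) && f (true, true)

/-- `f` holds for all feasible links with direct set `d` and set of sums `s`. -/
def Link.all (d s : ParSet) (f : Link → Bool) : Bool :=
  ParSet.all fun t => if (Link.mk d t).feasible s then f ⟨d, t⟩ else true

/-- `f` holds for all feasible configurations. -/
def Config.all (f : Config → Bool) : Bool :=
  ParSet.all fun d01 => ParSet.all fun d02 => ParSet.all fun d10 => ParSet.all fun d12 =>
  ParSet.all fun d20 => ParSet.all fun d21 =>
  Link.all d01 (d02.sum d21) fun x01 => Link.all d02 (d01.sum d12) fun x02 =>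
  Link.all d10 (d12.sum d20) fun x10 => Link.all d12 (d10.sum d02) fun x12 =>
  Link.all d20 (d21.sum d10) fun x20 => Link.all d21 (d20.sum d01) fun x21 =>
  f ⟨x01, x02, x10, x12, x20, x21⟩

theorem ParSet.of_all {f : ParSet → Bool} (h : ParSet.all f = true) (s : ParSet) : f s = true := by
  simp only [ParSet.all, Bool.and_eq_true] at h
  rcases s with ⟨_ | _, _ | _⟩
  exacts [h.1.1.1, h.1.2, h.1.1.2, h.2]

theorem Link.of_all {s : ParSet} {f : Link → Bool} (x : Link) (h : Link.all x.direct s f = true)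
    (hx : x.feasible s = true) : f x = true := by
  have := ParSet.of_all h x.total
  rwa [if_pos hx] at this

theorem Config.of_all {f : Config → Bool} (h : Config.all f = true) {c : Config}
    (hc : c.feasible = true) : f c = true := by
  simp only [Config.feasible, Bool.and_eq_true] at hc
  obtain ⟨⟨⟨⟨⟨h1, h2⟩, h3⟩, h4⟩, h5⟩, h6⟩ := hc
  have := ParSet.of_all (ParSet.of_all (ParSet.of_all (ParSet.of_all (ParSet.of_all (ParSet.of_all h
    c.x01.direct) c.x02.direct) c.x10.direct) c.x12.direct) c.x20.direct) c.x21.direct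
  exact Link.of_all c.x21 (Link.of_all c.x20 (Link.of_all c.x12 (Link.of_all c.x10
    (Link.of_all c.x02 (Link.of_all c.x01 this h1) h2) h3) h4) h5) h6

/-- The exhaustive search over the feasible configurations. -/
theorem all_settled : Config.all Config.settled = true := by
  decide +kernel

end Coverage

/-! ### Existence of planar networks -/

section Existence

theorem ParSet.sum_comm (s t : ParSet) : s.sum t = t.sum s := by
  revert s t; decide

theorem Config.feasible_swap {c : Config} (h : c.feasible = true) : c.swap.feasible = true := by
  simp only [Config.feasible, Config.swap, Bool.and_eq_true] at h ⊢
  tauto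

theorem Config.feasible_rotate {c : Config} (h : c.feasible = true) :
    c.rotate.feasible = true := by
  simp only [Config.feasible, Config.rotate, Bool.and_eq_true] at h ⊢
  tauto

theorem Config.feasible_reverse {c : Config} (h : c.feasible = true) :
    c.reverse.feasible = true := by
  simp only [Config.feasible, Config.reverse, Bool.and_eq_true] at h ⊢
  simp only [ParSet.sum_comm c.x12.direct, ParSet.sum_comm c.x20.direct c.x01.direct,
    ParSet.sum_comm c.x02.direct c.x10.direct] at h ⊢
  simp only [ParSet.sum_comm c.x21.direct, ParSet.sum_comm c.x01.direct] at h ⊢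
  tauto

/-- A property that is preserved by the generators of the symmetries holds for an image of a
configuration if and only if it holds for the configuration. -/
theorem Config.iff_of_mem_images {P : Config → Prop} (h1 : ∀ c, P c → P c.swap)
    (h2 : ∀ c, P c → P c.rotate) (h3 : ∀ c, P c → P c.reverse) {c d : Config}
    (hd : d ∈ c.images) : P d ↔ P c := by
  have s (c) : P c.swap ↔ P c := ⟨h1 c.swap, h1 c⟩
  have r (c) : P c.rotate ↔ P c := ⟨fun h => h2 _ (h2 _ h), h2 c⟩
  have v (c) : P c.reverse ↔ P c := ⟨h3 c.reverse, h3 c⟩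
  simp only [Config.images, List.map_cons, List.map_nil, List.cons_append,
    List.nil_append, List.mem_cons, List.not_mem_nil, or_false] at hd
  rcases hd with rfl | rfl | rfl | rfl | rfl | rfl | rfl | rfl | rfl | rfl | rfl | rfl <;>
    simp only [s, r, v]

theorem Config.planar_swap {c : Config} (h : c.Planar) : c.swap.Planar := by
  obtain ⟨D, hD, τ, hτ, hc⟩ := h
  exact ⟨D, hD, (Equiv.swap 0 1).toEmbedding.trans τ, fun i => hτ _, hc.swap⟩

theorem Config.planar_rotate {c : Config} (h : c.Planar) : c.rotate.Planar := by
  obtain ⟨D, hD, τ, hτ, hc⟩ := h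
  exact ⟨D, hD, (finRotate 3).toEmbedding.trans τ, fun i => hτ _, hc.rotate⟩

theorem Config.planar_reverse {c : Config} (h : c.Planar) : c.reverse.Planar := by
  obtain ⟨D, hD, τ, hτ, hc⟩ := h
  exact ⟨revDigraph D, fun a b hab => (hD _ _ hab).symm, τ, hτ, hc.reverse⟩

theorem planeAdj_of_lt : ∀ a b : Fin 18, a < 3 → b < 3 → a ≠ b → PlaneAdj a b := by
  decide +kernel

theorem exists_planeAdj_path : ∀ a b : Fin 18, a < 3 → b < 3 → a ≠ b →
    ∃ m, ¬ m < 3 ∧ PlaneAdj a m ∧ PlaneAdj m b ∧ (∀ c, PlaneAdj m c → c = a ∨ c = b) ∧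
      ∀ c, PlaneAdj c m → c = a ∨ c = b := by
  decide +kernel

theorem not_planeAdj_self : ∀ a, ¬ PlaneAdj a a := by
  decide +kernel

/-- Odd paths are added as arcs, even paths through the vertex of the plane graph that is adjacent
to the two terminals only. -/
theorem Config.planar_addPath {c : Config} (q : Bool) (h : c.Planar) : (c.addPath q).Planar := by
  obtain ⟨D, hD, τ, hτ, hc⟩ := h
  have h01 : τ 0 ≠ τ 1 := τ.injective.ne (by decide)
  have h02 : τ 0 ≠ τ 2 := τ.injective.ne (by decide)
  have h12 : τ 1 ≠ τ 2 := τ.injective.ne (by decide)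
  cases q with
  | true =>
    refine ⟨⟨fun a b => D.Adj a b ∨ a = τ 0 ∧ b = τ 1⟩, ?_, τ, hτ, ?_⟩
    · rintro a b (hab | ⟨rfl, rfl⟩)
      · exact hD a b hab
      · exact planeAdj_of_lt _ _ (hτ 0) (hτ 1) h01
    · exact (isEar_arc h01 fun a b => Iff.rfl).describes h01 h02 h12 (by simp [pathParity]) hc
  | false =>
    obtain ⟨m, hm, hm1, hm2, hm3, hm4⟩ := exists_planeAdj_path _ _ (hτ 0) (hτ 1) h01
    have hm' : ∀ i, m ≠ τ i := by
      rintro i rfl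
      exact hm (hτ i)
    have hadj : ∀ a b, (D.Adj a b ∨ a = τ 0 ∧ b = m ∨ a = m ∧ b = τ 1) → PlaneAdj a b := by
      rintro a b (hab | ⟨rfl, rfl⟩ | ⟨rfl, rfl⟩)
      · exact hD a b hab
      · exact hm1
      · exact hm2
    refine ⟨⟨fun a b => D.Adj a b ∨ a = τ 0 ∧ b = m ∨ a = m ∧ b = τ 1⟩, hadj, τ, hτ, ?_⟩
    refine (isEar_path h01 (hm' 0) (hm' 1) (hm' 2) (fun a b => Iff.rfl)
      (fun a h => hm3 a (hadj _ _ h)) (fun a h => hm4 a (hadj _ _ h))).describes h01 h02 h12 ?_ hc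
    simp [pathParity]
    rfl

theorem mem_of_mem_select {α : Type*} {a : α} {l : List α} {n : ℕ} (h : a ∈ select l n) :
    a ∈ l := by
  induction l generalizing n with
  | nil => exact h
  | cons b l ih =>
    rw [select] at h
    split at h
    · rcases List.mem_cons.1 h with rfl | h
      · exact List.mem_cons_self
      · exact List.mem_cons_of_mem _ (ih h)
    · exact List.mem_cons_of_mem _ (ih h)

theorem Config.planar_configOf (n : ℕ) :
    (configOf (select coreArcs n) (0 : Fin 18) 1 2).Planar := by
  have hτ : Function.Injective ![(0 : Fin 18), 1, 2] := by decide
  refine ⟨digraphOf (select coreArcs n), fun a b hab => ?_, ⟨_, hτ⟩,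
    (by decide : ∀ i : Fin 3, ![(0 : Fin 18), 1, 2] i < 3),
    describes_configOf _ _ _ _⟩
  have h1 : (a, b) ∈ coreArcs := mem_of_mem_select hab
  obtain ⟨e, he, h2⟩ := List.mem_flatMap.1 h1
  rcases List.mem_cons.1 h2 with rfl | h2
  · exact .inl (List.mem_append_right _ he)
  · have h3 : (b, a) = e := congrArg Prod.swap (List.mem_singleton.1 h2)
    exact .inr (List.mem_append_right _ (h3 ▸ he))

theorem Link.feasible_erase : ∀ (q : Bool) (d t s : ParSet), (Link.mk d t).feasible s = true →
    (Link.mk (d.erase q) ((d.erase q).restrict t s)).feasible s = true := by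
  decide +kernel

theorem Link.feasible_restrict : ∀ (q : Bool) (e f d t : ParSet),
    (Link.mk d t).feasible (e.sum f) = true →
    (Link.mk d (d.restrict t ((e.erase q).sum f))).feasible ((e.erase q).sum f) = true := by
  decide +kernel

theorem Config.feasible_removePath (q : Bool) {c : Config} (h : c.feasible = true) :
    (c.removePath q).feasible = true := by
  simp only [Config.feasible, Bool.and_eq_true] at h ⊢
  obtain ⟨⟨⟨⟨⟨h1, h2⟩, h3⟩, h4⟩, h5⟩, h6⟩ := h
  rw [ParSet.sum_comm] at h6
  refine ⟨⟨⟨⟨⟨Link.feasible_erase q _ _ _ h1, Link.feasible_restrict q _ _ _ _ h2⟩, h3⟩, h4⟩, h5⟩,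
    ?_⟩
  simp only [Config.removePath, ParSet.sum_comm c.x20.direct]
  exact Link.feasible_restrict q _ _ _ _ h6

theorem ParSet.erase_union : ∀ (q : Bool) (d : ParSet), (bif q then d.2 else d.1) = true →
    (d.erase q).union (.single q) = d ∧ (d.erase q).card < d.card := by
  decide +kernel

theorem ParSet.restrict_union_single : ∀ (q : Bool) (d t s : ParSet),
    (Link.mk d t).feasible s = true → (bif q then d.2 else d.1) = true →
    (d.1 && d.2 || s.subset t) = true →
    ((d.erase q).restrict t s).union (.single q) = t := by
  decide +kernel

theorem ParSet.restrict_union_sum : ∀ (q : Bool) (e f d t : ParSet),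
    (Link.mk d t).feasible (e.sum f) = true → (bif q then e.2 else e.1) = true →
    ((single q).sum f).subset t = true →
    (d.restrict t ((e.erase q).sum f)).union ((single q).sum f) = t := by
  decide +kernel

theorem Config.addPath_removePath {q : Bool} {c : Config} (h : c.feasible = true)
    (hq : c.reducibleBy q = true) : (c.removePath q).addPath q = c := by
  simp only [Config.feasible, Config.reducibleBy, Bool.and_eq_true] at h hq
  obtain ⟨⟨⟨⟨⟨h1, h2⟩, -⟩, -⟩, -⟩, h6⟩ := h
  obtain ⟨⟨⟨hq, hq1⟩, hq2⟩, hq3⟩ := hq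
  rw [ParSet.sum_comm] at h6 hq3
  simp only [Config.removePath, Config.addPath, ParSet.sum_comm c.x20.direct]
  rw [(ParSet.erase_union q _ hq).1, ParSet.restrict_union_single q _ _ _ h1 hq hq1,
    ParSet.restrict_union_sum q _ _ _ _ h2 hq hq2, ParSet.restrict_union_sum q _ _ _ _ h6 hq hq3]

theorem Config.size_removePath_lt {q : Bool} {c : Config} (hq : c.reducibleBy q = true) :
    (c.removePath q).size < c.size := by
  simp only [Config.reducibleBy, Bool.and_eq_true] at hq
  have := (ParSet.erase_union q _ hq.1.1.1).2
  simp only [Config.size, Config.removePath]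
  omega

/-- Every feasible configuration is realized in the plane graph. -/
theorem Config.planar_of_feasible {c : Config} (h : c.feasible = true) : c.Planar := by
  induction hn : c.size using Nat.strong_induction_on generalizing c with
  | _ n ih
  have himg : ∀ d ∈ c.images, d.Planar → c.Planar := fun d hd =>
    (Config.iff_of_mem_images (P := Config.Planar) (fun _ => planar_swap) (fun _ => planar_rotate)
      (fun _ => planar_reverse) hd).1
  have hset := Config.of_all all_settled h
  simp only [Config.settled, Bool.or_eq_true, Bool.and_eq_true, List.any_eq_true] at hset
  rcases hset with ⟨d, hd, hred⟩ | ⟨d, hd, -, r, hr, hrd⟩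
  · have hdf : d.feasible = true :=
      (Config.iff_of_mem_images (P := fun c => c.feasible = true) (fun _ => feasible_swap)
        (fun _ => feasible_rotate) (fun _ => feasible_reverse) hd).2 h
    have hds : d.size = n :=
      (Config.iff_of_mem_images (P := fun c => c.size = n)
        (fun c hc => by simp only [Config.size, Config.swap] at hc ⊢; omega)
        (fun c hc => by simp only [Config.size, Config.rotate] at hc ⊢; omega)
        (fun c hc => by simp only [Config.size, Config.reverse] at hc ⊢; omega) hd).2 hn
    obtain ⟨q, hq⟩ : ∃ q, d.reducibleBy q = true := by
      rcases hred with hq | hq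
      exacts [⟨_, hq⟩, ⟨_, hq⟩]
    refine himg d hd ?_
    rw [← Config.addPath_removePath hdf hq]
    exact planar_addPath q
      (ih _ (hds ▸ Config.size_removePath_lt hq) (feasible_removePath q hdf) rfl)
  · obtain ⟨e, he, her⟩ := coreTable_correct r hr
    obtain rfl : e = d := Config.code_injective (her.trans (Nat.eq_of_beq_eq_true hrd))
    exact himg e hd ((Config.iff_of_mem_images (P := Config.Planar) (fun _ => planar_swap)
      (fun _ => planar_rotate) (fun _ => planar_reverse) he).2 (planar_configOf _))

theorem parityConfig_eq_of_describes {L L' : TermDigraph} {c : Config}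
    (h : c.Describes L.graph (L.term 0) (L.term 1) (L.term 2))
    (h' : c.Describes L'.graph (L'.term 0) (L'.term 1) (L'.term 2)) :
    L'.parityConfig = L.parityConfig := by
  have key : ∀ x : Triple, ∃ z : Link,
      z.Describes L.graph (L.term x.1.1) (L.term x.1.2.1) (L.term x.1.2.2) ∧
      z.Describes L'.graph (L'.term x.1.1) (L'.term x.1.2.1) (L'.term x.1.2.2) := by
    intro x
    have hx := mem_triples x
    simp only [triples, List.mem_cons, List.not_mem_nil, or_false] at hx
    rcases hx with rfl | rfl | rfl | rfl | rfl | rfl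
    exacts [⟨_, h.x01, h'.x01⟩, ⟨_, h.x02, h'.x02⟩, ⟨_, h.x10, h'.x10⟩, ⟨_, h.x12, h'.x12⟩,
      ⟨_, h.x20, h'.x20⟩, ⟨_, h.x21, h'.x21⟩]
  have htot : ∀ {V : Type} (D : Digraph V) (u v w : V) (p : ZMod 2),
      (HasPathThrough D u v w p ∧ ¬ HasDirectPath D u v w p) ↔
        (∃ l, IsDiPath D u v l ∧ pathParity l = p) ∧ ¬ HasDirectPath D u v w p := by
    refine fun D u v w p => and_congr_left fun hd => ⟨?_, ?_⟩
    · rintro ⟨l, hl, -, hp⟩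
      exact ⟨l, hl, hp⟩
    · rintro ⟨l, hl, hp⟩
      by_contra hw
      exact hd ⟨l, hl, fun hwl => hw ⟨l, hl, hwl, hp⟩, hp⟩
  ext x p
  · obtain ⟨z, hz, hz'⟩ := key x
    simp only [TermDigraph.parityConfig, Finset.mem_filter, Finset.mem_univ, true_and,
      ← hz.direct, ← hz'.direct]
  · obtain ⟨z, hz, hz'⟩ := key x
    simp only [TermDigraph.parityConfig, Finset.mem_filter, Finset.mem_univ, true_and]
    rw [htot, htot, ← hz.direct, ← hz'.direct, ← hz.total, ← hz'.total]

/-- Every digraph with three terminals has a small planar parity mimicking network. -/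
theorem exists_parityMimicking (L : TermDigraph) : ∃ L' : TermDigraph, IsParityMimicking L' L ∧
    L'.n ≤ 18 ∧ (∀ v, ¬ L'.graph.Adj v v) ∧ PlanarWithTerminalsOnFace L' := by
  obtain ⟨c, hc⟩ := Config.exists_describes L.graph (L.term 0) (L.term 1) (L.term 2)
  obtain ⟨D, hD, τ, hτ, hc'⟩ := Config.planar_of_feasible (hc.feasible
    (L.term.injective.ne (by decide)) (L.term.injective.ne (by decide))
    (L.term.injective.ne (by decide)))
  refine ⟨⟨18, D, τ⟩, parityConfig_eq_of_describes hc hc', le_rfl,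
    fun v hv => not_planeAdj_self v (hD v v hv), ?_⟩
  obtain ⟨Δ, F, hF, h⟩ := isStraightDrawing_planePoint.exists_face (G := underlying D)
    (fun a b hab => by
      rcases ((SimpleGraph.fromRel_adj _ _ _).1 hab).2 with hab | hab
      · exact hD _ _ hab
      · exact (hD _ _ hab).symm)
    (by decide +kernel)
  refine ⟨Δ, F, hF, fun i => h _ ?_⟩
  have hpar : ∀ v : Fin 18, v < 3 → (planePoint v).2 = (planePoint v).1 ^ 2 := by decide +kernel
  exact hpar _ (hτ i)

end Existence

end ParityNet

/-- A single polynomial-time algorithm, given a digraph `L` with three terminals together with its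
parity configuration, outputs a parity mimicking network of `L` that has at most 18 vertices and no
loops and is planar with its three terminals on a common face. -/
theorem mainTheorem2 :
    ∃ mimic : ParityNet.TermDigraph × ParityNet.ParityConfig → ParityNet.TermDigraph,
      Nonempty (Turing.TM2ComputableInPolyTime
        ParityNet.encodeInput ParityNet.TermDigraph.encode mimic) ∧
      ∀ (L : ParityNet.TermDigraph) (P : ParityNet.ParityConfig), P = L.parityConfig →
        ParityNet.IsParityMimicking (mimic (L, P)) L ∧
        (mimic (L, P)).n ≤ 18 ∧
        (∀ v, ¬ (mimic (L, P)).graph.Adj v v) ∧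
        ParityNet.PlanarWithTerminalsOnFace (mimic (L, P)) := by
  classical
  -- Digraphs with the same configuration must get the same network, so the network is chosen for
  -- one digraph with the configuration that is read off from the first 24 bits of the input.
  choose f hf using ParityNet.exists_parityMimicking
  let L₀ : ParityNet.TermDigraph := ⟨3, ⟨fun _ _ => False⟩, Function.Embedding.refl _⟩
  let g : List Bool → ParityNet.TermDigraph := fun l =>
    if h : ∃ L : ParityNet.TermDigraph, L.parityConfig.encode = l then f h.choose else L₀
  refine ⟨_, ParityNet.nonempty_computableInPolyTime_of_prefix ParityNet.encodeInput
    ParityNet.TermDigraph.encode 24 g, ?_⟩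
  rintro L P rfl
  have htake : (ParityNet.encodeInput (L, L.parityConfig)).take 24 = L.parityConfig.encode :=
    List.take_left' (ParityNet.ParityConfig.encode_length _)
  have hex : ∃ L' : ParityNet.TermDigraph, L'.parityConfig.encode = L.parityConfig.encode :=
    ⟨L, rfl⟩
  have hg : g ((ParityNet.encodeInput (L, L.parityConfig)).take 24) = f hex.choose := by
    rw [htake]
    exact dif_pos hex
  have key : ∀ N, N = f hex.choose → ParityNet.IsParityMimicking N L ∧ N.n ≤ 18 ∧
      (∀ v, ¬ N.graph.Adj v v) ∧ ParityNet.PlanarWithTerminalsOnFace N := by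
    rintro _ rfl
    exact ⟨(hf hex.choose).1.trans (ParityNet.ParityConfig.encode_injective hex.choose_spec),
      (hf hex.choose).2⟩
  exact key _ hg
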